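/- Let $n\ge 1$, $1\le p<\infty$, and let $w$ be a weight on $(0,\infty)$, i.e. a nonnegative measurable function with $\int_0^r w(t)\,dt<\infty$ for all $r>0$. For measurable $f:\mathbb{R}^n\to\mathbb{R}$ let $f^*(t)=\inf\{s\ge 0: |\{x:|f(x)|>s\}|\le t\}$ be its non-increasing rearrangement, and let $\Lambda^p(\mathbb{R}^n,w)$ be the set of those $f$ (modulo equality a.e.) with $$\|f\|_{\Lambda^p(w)}=\Big(\int_0^\infty f^*(t)^p\,w(t)\,dt\Big)^{1/p}<\infty .$$ For locally integrable $f$ let $\mathcal{M}f(x)=\sup_{r>0}\frac1{|B(x,r)|}\int_{B(x,r)}|f(y)|\,dy$ be the centered Hardy--Littlewood maximal function (Euclidean balls). Assume that $\Lambda^p(\mathbb{R}^n,w)$ is a Banach space, i.e. that it is a vector space which is complete for some norm equivalent to $\|\cdot\|_{\Lambda^p(w)}$, or, in terms of the weight, that * if $p>1$: $w\in B_p$, i.e. there is $C$ with $\int_r^\infty (r/t)^p\,w(t)\,dt\le C\int_0^r w(t)\,dt$ for all $r>0$; * if $p=1$: $w\in B_{1,\infty}$, i.e. there is $C$ with $\frac1r\int_0^r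 w(t)\,dt\le \frac Cs\int_0^s w(t)\,dt$ for all $0<s\le r$. (Either form of the assumption suffices.) Then there is a function $f\in\Lambda^p(\mathbb{R}^n,w)$, not a.e. equal to a constant, with $\mathcal{M}f=f$ a.e. if and only if $$n\ge 3\quad\text{and}\quad \int_1^\infty \frac{w(t)}{t^{p(1-2/n)}}\,dt<\infty .$$ Moreover, if $p>1$, there is $n_0$ (depending on $p$ and $w$) such that for every $m\ge n_0$ this condition holds with $m$ in place of $n$, and so $\Lambda^p(\mathbb{R}^m,w)$ contains a non-constant fixed point of $\mathcal{M}$. -/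

import Mathlib

open MeasureTheory Set Filter Topology
open scoped ENNReal NNReal

noncomputable section

/-- The centered Hardy-Littlewood maximal function on `ℝⁿ`, with values in `[0, ∞]`. -/
def hlMaximal {n : ℕ} (f : EuclideanSpace ℝ (Fin n) → ℝ) (x : EuclideanSpace ℝ (Fin n)) : ℝ≥0∞ :=
  ⨆ (r : ℝ) (_ : 0 < r),
    (volume (Metric.ball x r))⁻¹ * ∫⁻ y in Metric.ball x r, ‖f y‖ₑ

/-- `f` is a locally integrable real function with `M f = f` almost everywhere. -/
def IsMaximalFixedPoint {n : ℕ} (f : EuclideanSpace ℝ (Fin n) → ℝ) : Prop :=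
  LocallyIntegrable f volume ∧
    ∀ᵐ x ∂(volume : Measure (EuclideanSpace ℝ (Fin n))),
      0 ≤ f x ∧ hlMaximal f x = ENNReal.ofReal (f x)

/-- `f` is not almost everywhere equal to a constant. -/
def IsNonconstant {n : ℕ} (f : EuclideanSpace ℝ (Fin n) → ℝ) : Prop :=
  ¬ ∃ c : ℝ, f =ᵐ[volume] fun _ => c

/-- The non-increasing rearrangement `f*(t) = inf {s ≥ 0 : |{|f| > s}| ≤ t}`
(equal to `∞` when no finite `s` qualifies). -/
def decRearrangement {n : ℕ} (f : EuclideanSpace ℝ (Fin n) → ℝ) (t : ℝ) : ℝ≥0∞ :=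
  sInf {s : ℝ≥0∞ | volume {x | s < ‖f x‖ₑ} ≤ ENNReal.ofReal t}

/-- A weight on `(0, ∞)`: nonnegative, and integrable on every `(0, r]`
(so that indicators of sets of finite measure have finite Lorentz functional). -/
structure IsLorentzWeight (w : ℝ → ℝ) : Prop where
  nonneg : ∀ t, 0 < t → 0 ≤ w t
  integrableOn : ∀ r, 0 < r → IntegrableOn w (Ioc 0 r) volume

/-- The functional `‖f‖ = (∫₀^∞ f*(t)^p w(t) dt)^(1/p)`. -/
def lorentzFunctional {n : ℕ} (p : ℝ) (w : ℝ → ℝ) (f : EuclideanSpace ℝ (Fin n) → ℝ) : ℝ≥0∞ :=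
  (∫⁻ t in Ioi (0 : ℝ), decRearrangement f t ^ p * ENNReal.ofReal (w t)) ^ (1 / p)

/-- Membership in the Lorentz space `Λ^p(ℝⁿ, w)`. -/
def MemLorentz {n : ℕ} (p : ℝ) (w : ℝ → ℝ) (f : EuclideanSpace ℝ (Fin n) → ℝ) : Prop :=
  AEStronglyMeasurable f volume ∧ lorentzFunctional p w f < ∞

/-- `Λ^p(ℝⁿ, w)` is a Banach space: it is a vector space, and it carries a norm
(functions being identified when they agree a.e.) that is equivalent to the Lorentz functional
and for which it is complete. -/
def IsBanachLorentz (n : ℕ) (p : ℝ) (w : ℝ → ℝ) : Prop :=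
  ∃ S : Submodule ℝ (EuclideanSpace ℝ (Fin n) → ℝ),
    (∀ f, f ∈ S ↔ MemLorentz p w f) ∧
    ∃ N : Seminorm ℝ S,
      (∀ f : S, N f = 0 ↔ (f : EuclideanSpace ℝ (Fin n) → ℝ) =ᵐ[volume] 0) ∧
      (∃ C : ℝ, 0 < C ∧ ∀ f : S,
        N f ≤ C * (lorentzFunctional p w (f : EuclideanSpace ℝ (Fin n) → ℝ)).toReal ∧
        (lorentzFunctional p w (f : EuclideanSpace ℝ (Fin n) → ℝ)).toReal ≤ C * N f) ∧
      ∀ u : ℕ → S, (∀ ε : ℝ, 0 < ε → ∃ K, ∀ i, K ≤ i → ∀ j, K ≤ j → N (u i - u j) < ε) →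
        ∃ f : S, Tendsto (fun i => N (u i - f)) atTop (𝓝 0)

/-- The class `B_p`: `∫_r^∞ (r/t)^p w(t) dt ≤ C ∫_0^r w(t) dt` for all `r > 0`. -/
def IsBp (p : ℝ) (w : ℝ → ℝ) : Prop :=
  ∃ C : ℝ≥0, ∀ r : ℝ, 0 < r →
    ∫⁻ t in Ioi r, ENNReal.ofReal ((r / t) ^ p * w t) ≤
      C * ∫⁻ t in Ioc 0 r, ENNReal.ofReal (w t)

/-- The class `B_{1,∞}`: `(1/r) ∫_0^r w ≤ C (1/s) ∫_0^s w` for all `0 < s ≤ r`. -/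
def IsBOneInfty (w : ℝ → ℝ) : Prop :=
  ∃ C : ℝ≥0, ∀ s r : ℝ, 0 < s → s ≤ r →
    (∫⁻ t in Ioc 0 r, ENNReal.ofReal (w t)) / ENNReal.ofReal r ≤
      C * ((∫⁻ t in Ioc 0 s, ENNReal.ofReal (w t)) / ENNReal.ofReal s)

/-- `n ≥ 3` and `∫_1^∞ w(t) t^{-p(1-2/n)} dt < ∞`. -/
def LorentzTailCondition (n : ℕ) (p : ℝ) (w : ℝ → ℝ) : Prop :=
  3 ≤ n ∧ IntegrableOn (fun t : ℝ => w t / t ^ (p * (1 - 2 / (n : ℝ)))) (Ioi 1) volume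

end

/-!
A function `f` with `M f = f` is nonnegative and dominates its averages over all balls, so it is a
nonnegative superharmonic function, and nonconstant ones of these exist only for `n ≥ 3`. There the
slowest admissible size is that of the fundamental solution `‖x‖^(2 - n)`, whose rearrangement is
`t^(-(1 - 2/n))` up to a constant; this is where the integral condition comes from.

* The function `(1 + ‖x‖²)^((2 - n)/2)` has nonpositive Laplacian. The mean value inequality
  `le_setIntegral_ball_of_laplacian_nonneg` makes it a fixed point of `M`. It is proved by
  differentiating `r ↦ ∫_{B(0,1)} g (x + r y) dy` and integrating by parts against the Lipschitz
  function `(1 - ‖y‖²)⁺ / 2`.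
* Conversely, the ball averages of a fixed point are continuous and superharmonic in the sense of
  ball averages (`isSuperMean_setLIntegral_ball`). Comparing them on annuli with the strictly
  subharmonic powers `‖x‖^(-2β)`, `2β > max (n - 2) 0`, and letting `2β` tend to its limit bounds them
  from below by a multiple of `‖x‖^(-max (n - 2) 0)` (`IsSuperMean.mul_sq_rpow_le'`). For `n ≤ 2` this
  forces every ball average, hence `M f`, to be constant; for `n ≥ 3` it shows that `f` is at least a
  multiple of `(1 + ‖x‖²)^((2 - n)/2)`, so that the latter function lies in `Λ^p(w)` too.
* The rearrangement of that function is computed exactly, so its Lorentz functional is finite if and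
  only if the tail integral converges (`exists_fixedPoint_iff`).

For `p > 1` put `W(t) = ∫_0^t w` and `a_k(r) = 2^(-kp) W(2^k r)`. It is enough to find `K` such that
`a_K(r) ≤ W(r) / 2` for all `r`: then `W(t) = O(t^(p - δ))` for some `δ > 0`, and the tail integral
converges as soon as `2p/m < δ` (`exists_forall_lorentzTailCondition`). Under `B_p`, the numbers
`a_k(r)` are summable and almost decreasing in `k`, uniformly in `r`, so `a_K(r) = O(1/K) W(r)`. If
`Λ^p(w)` is normable, take `N = 2^K` disjoint sets of measure `r` and the step functions whose values
there are the cyclic shifts of `1, 1/2, …, 1/N`. They are equimeasurable, with Lorentz functional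
`O((K W(r))^(1/p))`, and they add up to a constant of size about `K` on a set of measure `N r`; the
triangle inequality then gives `a_K(r) = O(K^(1 - p)) W(r)`.
-/

/-! ### The mean value inequality for subharmonic functions -/

section MeanValue

open Metric
open scoped InnerProductSpace Laplacian

variable {E : Type*} [NormedAddCommGroup E]

/-- The solution `(1 - ‖y‖²)⁺ / 2` of `∇η = -y` in the unit ball that vanishes on its boundary. -/
noncomputable def ballBump (y : E) : ℝ := max 0 ((1 - ‖y‖ ^ 2) / 2)

theorem ballBump_nonneg (y : E) : 0 ≤ ballBump y := le_max_left _ _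

theorem ballBump_eq_zero {y : E} (hy : 1 ≤ ‖y‖) : ballBump y = 0 :=
  max_eq_left (by nlinarith)

theorem ballBump_lipschitz : LipschitzWith 1 (ballBump : E → ℝ) := by
  have key : ∀ y z : E, ‖z‖ ≤ ‖y‖ → |ballBump y - ballBump z| ≤ ‖y - z‖ := by
    intro y z h
    have h1 := norm_sub_norm_le y z
    have hy := norm_nonneg y
    have hz := norm_nonneg z
    unfold ballBump
    rcases le_total 1 ‖y‖ with hy1 | hy1
    · rw [max_eq_left (by nlinarith)]
      rcases le_total 1 ‖z‖ with hz1 | hz1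
      · rw [max_eq_left (by nlinarith)]; simp
      · rw [max_eq_right (by nlinarith), abs_le]
        constructor <;> nlinarith
    · rw [max_eq_right (by nlinarith), max_eq_right (by nlinarith), abs_le]
      constructor <;> nlinarith
  refine LipschitzWith.of_dist_le_mul fun y z => ?_
  rw [NNReal.coe_one, one_mul, Real.dist_eq, dist_eq_norm]
  rcases le_total ‖z‖ ‖y‖ with h | h
  · exact key y z h
  · rw [abs_sub_comm, norm_sub_rev]; exact key z y h

variable [InnerProductSpace ℝ E]

theorem lineDeriv_ballBump_of_lt {y : E} (hy : ‖y‖ < 1) (v : E) :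
    lineDeriv ℝ ballBump y v = -⟪y, v⟫_ℝ := by
  have h1 : HasFDerivAt (fun z : E => (1 - ‖z‖ ^ 2) / 2) ((-1 : ℝ) • innerSL ℝ y) y := by
    have := ((hasStrictFDerivAt_norm_sq y).hasFDerivAt.const_sub 1).mul_const (2⁻¹ : ℝ)
    refine (this.congr_fderiv ?_).congr_of_eventuallyEq (Eventually.of_forall fun z => ?_)
    · ext w; simp
    · simp [div_eq_mul_inv]
  have h2 : HasFDerivAt (ballBump : E → ℝ) ((-1 : ℝ) • innerSL ℝ y) y := by
    refine h1.congr_of_eventuallyEq ?_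
    have : ∀ᶠ z : E in 𝓝 y, ‖z‖ < 1 := continuous_norm.continuousAt.eventually_lt_const hy
    filter_upwards [this] with z hz
    exact max_eq_right (by nlinarith [norm_nonneg z])
  rw [(h2.hasLineDerivAt v).lineDeriv]
  simp

theorem lineDeriv_ballBump_of_gt {y : E} (hy : 1 < ‖y‖) (v : E) :
    lineDeriv ℝ ballBump y v = 0 := by
  have h2 : HasFDerivAt (ballBump : E → ℝ) (0 : E →L[ℝ] ℝ) y := by
    refine (hasFDerivAt_const (0 : ℝ) y).congr_of_eventuallyEq ?_
    have : ∀ᶠ z : E in 𝓝 y, 1 < ‖z‖ := continuous_norm.continuousAt.eventually_const_lt hy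
    filter_upwards [this] with z hz
    exact ballBump_eq_zero hz.le
  rw [(h2.hasLineDerivAt v).lineDeriv]
  simp

variable [FiniteDimensional ℝ E]

theorem laplacian_radial {G : ℝ → ℝ} (hG : ContDiff ℝ 2 G) (z : E) :
    Δ (fun y : E => G (‖y‖ ^ 2)) z =
      2 * Module.finrank ℝ E * deriv G (‖z‖ ^ 2) + 4 * ‖z‖ ^ 2 * deriv (deriv G) (‖z‖ ^ 2) := by
  set b := stdOrthonormalBasis ℝ E with hb
  have hG1 : ContDiff ℝ 1 (deriv G) := by
    have : ContDiff ℝ (1 + 1) G := hG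
    exact (contDiff_succ_iff_deriv.1 this).2.2
  have hsq : ∀ y : E, HasFDerivAt (fun y : E => ‖y‖ ^ 2) ((2 : ℝ) • innerSL ℝ y) y := fun y => by
    refine (hasStrictFDerivAt_norm_sq y).hasFDerivAt.congr_fderiv ?_
    ext w
    simp
  have h1 : fderiv ℝ (fun y : E => G (‖y‖ ^ 2)) =
      fun y => (2 * deriv G (‖y‖ ^ 2)) • innerSL ℝ y := by
    ext1 y
    have := ((hG.differentiable (by norm_num)) (‖y‖ ^ 2)).hasDerivAt.comp_hasFDerivAt y (hsq y)
    have h2 := this.fderiv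
    simp only [Function.comp_def] at h2
    rw [h2, smul_smul, mul_comm]
  have h2 : ∀ v : E, fderiv ℝ (fderiv ℝ (fun y : E => G (‖y‖ ^ 2))) z v v =
      2 * deriv G (‖z‖ ^ 2) * ⟪v, v⟫_ℝ + 4 * deriv (deriv G) (‖z‖ ^ 2) * ⟪z, v⟫_ℝ ^ 2 := by
    intro v
    rw [h1]
    have h3 := ((((hG1.differentiable one_ne_zero)
      (‖z‖ ^ 2)).hasDerivAt.comp_hasFDerivAt z (hsq z)).const_mul 2).smul
      (innerSL ℝ (E := E)).hasFDerivAt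
    have h4 := h3.fderiv
    simp only [Function.comp_def, Pi.smul_def'] at h4
    rw [h4]
    change 2 * deriv G (‖z‖ ^ 2) * ⟪v, v⟫_ℝ +
      2 * (deriv (deriv G) (‖z‖ ^ 2) * (2 * ⟪z, v⟫_ℝ)) * ⟪z, v⟫_ℝ = _
    ring
  rw [InnerProductSpace.laplacian_eq_iteratedFDeriv_orthonormalBasis _ b]
  simp_rw [iteratedFDeriv_two_apply]
  simp only [Matrix.cons_val_zero, Matrix.cons_val_one, h2, Finset.sum_add_distrib]
  rw [← Finset.mul_sum, ← Finset.mul_sum]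
  have e1 : ∑ i, ⟪b i, b i⟫_ℝ = Module.finrank ℝ E := by simp
  have e2 : ∑ i, ⟪z, b i⟫_ℝ ^ 2 = ‖z‖ ^ 2 := by
    rw [← b.sum_sq_norm_inner_left z]
    simp
  rw [e1, e2]
  ring

variable [MeasurableSpace E] [BorelSpace E]

/-- Integration by parts against `ballBump` in the direction `v`. -/
theorem integral_ball_inner_mul {φ : E → ℝ} (hφ : ContDiff ℝ 1 φ) (hc : HasCompactSupport φ)
    (v : E) :
    ∫ y in ball (0 : E) 1, ⟪y, v⟫_ℝ * φ y = ∫ y, ballBump y * fderiv ℝ φ y v := by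
  obtain ⟨D, hD⟩ := ContDiff.lipschitzWith_of_hasCompactSupport hc hφ one_ne_zero
  have h := LipschitzWith.integral_lineDeriv_mul_eq (μ := (volume : Measure E)) ballBump_lipschitz hD hc v
  have hR : ∫ y, lineDeriv ℝ φ y (-v) * ballBump y = -∫ y, ballBump y * fderiv ℝ φ y v := by
    rw [← integral_neg]
    congr 1; ext y
    rw [((hφ.differentiable one_ne_zero) y).lineDeriv_eq_fderiv, map_neg]
    ring
  have hL : ∫ y, lineDeriv ℝ ballBump y v * φ y = -∫ y in ball (0 : E) 1, ⟪y, v⟫_ℝ * φ y := by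
    rw [← integral_neg, ← integral_indicator measurableSet_ball]
    refine integral_congr_ae ?_
    have : ∀ᵐ y : E, y ∉ sphere (0 : E) 1 :=
      measure_eq_zero_iff_ae_notMem.1 (Measure.addHaar_sphere_of_ne_zero _ 0 one_ne_zero)
    filter_upwards [this] with y hy
    rw [mem_sphere_zero_iff_norm] at hy
    rcases lt_or_gt_of_ne hy with hy | hy
    · rw [lineDeriv_ballBump_of_lt hy, indicator_of_mem (by simpa using hy)]
      ring
    · rw [lineDeriv_ballBump_of_gt hy, indicator_of_notMem (by simpa using hy.le)]
      ring
  rw [hL, hR] at h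
  linarith

/-- The derivative at `r` of `r ↦ ∫_{B(0,1)} g (x + r y) dy` is `r ∫ η(y) Δg(x + r y) dy`. -/
theorem integral_ball_fderiv_eq {g : E → ℝ} (hg : ContDiff ℝ 2 g) (hc : HasCompactSupport g)
    (x : E) {r : ℝ} (hr : 0 < r) :
    ∫ y in ball (0 : E) 1, fderiv ℝ g (x + r • y) y =
      r * ∫ y, ballBump y * Δ g (x + r • y) := by
  set b := stdOrthonormalBasis ℝ E with hb
  have hg1 : ContDiff ℝ 1 (fderiv ℝ g) := hg.fderiv_right (by norm_num)
  have haff : ContDiff ℝ 1 (fun y : E => x + r • y) := by fun_prop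
  have hemb : IsClosedEmbedding (fun y : E => x + r • y) :=
    (Homeomorph.addLeft x).isClosedEmbedding.comp
      (Homeomorph.smulOfNeZero r hr.ne').isClosedEmbedding
  have hφ : ∀ v : E, ContDiff ℝ 1 (fun y => fderiv ℝ g (x + r • y) v) := fun v =>
    (hg1.comp haff).clm_apply contDiff_const
  have hφc : ∀ v : E, HasCompactSupport (fun y => fderiv ℝ g (x + r • y) v) := fun v =>
    ((hc.fderiv (𝕜 := ℝ)).comp_isClosedEmbedding hemb).comp_left (g := fun L : E →L[ℝ] ℝ => L v)
      (by simp)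
  have hd : ∀ v y : E, fderiv ℝ (fun y => fderiv ℝ g (x + r • y) v) y v =
      r * fderiv ℝ (fderiv ℝ g) (x + r • y) v v := by
    intro v y
    have h1 : HasFDerivAt (fun y : E => x + r • y) (r • ContinuousLinearMap.id ℝ E) y :=
      ((hasFDerivAt_id y).const_smul r).const_add x
    have h2 := ((hg1.differentiable one_ne_zero) (x + r • y)).hasFDerivAt.comp y h1
    have h3 := h2.clm_apply (hasFDerivAt_const v y)
    have h4 := h3.fderiv
    simp only [Function.comp_def] at h4
    rw [h4]
    simp
  have hL : ∀ y : E, fderiv ℝ g (x + r • y) y =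
      ∑ i, ⟪y, b i⟫_ℝ * fderiv ℝ g (x + r • y) (b i) := by
    intro y
    conv_lhs => rw [← b.sum_repr' y, map_sum]
    refine Finset.sum_congr rfl fun i _ => ?_
    rw [map_smul, smul_eq_mul, real_inner_comm, b.sum_repr']
  have hR : ∀ y : E, Δ g (x + r • y) = ∑ i, fderiv ℝ (fderiv ℝ g) (x + r • y) (b i) (b i) := by
    intro y
    rw [InnerProductSpace.laplacian_eq_iteratedFDeriv_orthonormalBasis g b]
    refine Finset.sum_congr rfl fun i _ => ?_
    rw [iteratedFDeriv_two_apply]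
    simp
  have hcontL : ∀ i, Integrable (fun y : E => ⟪y, b i⟫_ℝ * fderiv ℝ g (x + r • y) (b i)) := by
    intro i
    refine Continuous.integrable_of_hasCompactSupport ?_ ((hφc (b i)).mul_left)
    exact (continuous_id.inner continuous_const).mul (hφ (b i)).continuous
  have hcontR : ∀ i, Integrable (fun y : E => ballBump y *
      fderiv ℝ (fun y => fderiv ℝ g (x + r • y) (b i)) y (b i)) := by
    intro i
    refine Continuous.integrable_of_hasCompactSupport ?_ (HasCompactSupport.mul_left ?_)
    · exact ballBump_lipschitz.continuous.mul
        (((hφ (b i)).continuous_fderiv one_ne_zero).clm_apply continuous_const)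
    · exact ((hφc (b i)).fderiv (𝕜 := ℝ)).comp_left (g := fun L : E →L[ℝ] ℝ => L (b i)) (by simp)
  simp_rw [hL]
  rw [integral_finsetSum _ fun i _ => (hcontL i).integrableOn]
  calc ∑ i, ∫ y in ball (0 : E) 1, ⟪y, b i⟫_ℝ * fderiv ℝ g (x + r • y) (b i)
      = ∑ i, ∫ y, ballBump y * fderiv ℝ (fun y => fderiv ℝ g (x + r • y) (b i)) y (b i) :=
        Finset.sum_congr rfl fun i _ => integral_ball_inner_mul (hφ (b i)) (hφc (b i)) (b i)
    _ = ∫ y, ∑ i, ballBump y * fderiv ℝ (fun y => fderiv ℝ g (x + r • y) (b i)) y (b i) :=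
        (integral_finsetSum _ fun i _ => hcontR i).symm
    _ = r * ∫ y, ballBump y * Δ g (x + r • y) := by
        rw [← integral_const_mul]
        congr 1; ext y
        simp_rw [hd, hR, Finset.mul_sum]
        exact Finset.sum_congr rfl fun i _ => by ring

theorem hasDerivAt_integral_ball {g : E → ℝ} (hg : ContDiff ℝ 1 g) (hc : HasCompactSupport g)
    (x : E) (r : ℝ) :
    HasDerivAt (fun r : ℝ => ∫ y in ball (0 : E) 1, g (x + r • y))
      (∫ y in ball (0 : E) 1, fderiv ℝ g (x + r • y) y) r := by
  have hcd : Continuous (fderiv ℝ g) := hg.continuous_fderiv one_ne_zero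
  obtain ⟨M, hM⟩ := hcd.bounded_above_of_compact_support (hc.fderiv (𝕜 := ℝ))
  have hfin : volume (ball (0 : E) 1) ≠ ∞ := measure_ball_lt_top.ne
  have hM0 : 0 ≤ M := (norm_nonneg _).trans (hM 0)
  refine (hasDerivAt_integral_of_dominated_loc_of_deriv_le (s := univ) (bound := fun _ => M)
    (F := fun (t : ℝ) (y : E) => g (x + t • y)) (F' := fun t y => fderiv ℝ g (x + t • y) y)
    univ_mem ?_ ?_ ?_ ?_ ?_ ?_).2
  · refine Eventually.of_forall fun t => Continuous.aestronglyMeasurable ?_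
    exact hg.continuous.comp (by fun_prop)
  · have : Continuous fun y : E => g (x + r • y) := hg.continuous.comp (by fun_prop)
    exact (this.continuousOn.integrableOn_compact (isCompact_closedBall (0 : E) 1)).mono_set
      ball_subset_closedBall
  · have : Continuous fun y : E => fderiv ℝ g (x + r • y) := hcd.comp (by fun_prop)
    exact (this.clm_apply continuous_id).aestronglyMeasurable
  · filter_upwards [ae_restrict_mem measurableSet_ball] with y hy t _
    rw [mem_ball_zero_iff] at hy
    calc ‖fderiv ℝ g (x + t • y) y‖ ≤ ‖fderiv ℝ g (x + t • y)‖ * ‖y‖ :=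
          ContinuousLinearMap.le_opNorm _ _
      _ ≤ M * 1 := by gcongr; exact hM _
      _ = M := mul_one M
  · exact integrableOn_const hfin
  · refine Eventually.of_forall fun y t _ => ?_
    have h1 : HasDerivAt (fun t : ℝ => x + t • y) y t := by
      simpa using ((hasDerivAt_id t).smul_const y).const_add x
    exact ((hg.differentiable one_ne_zero) (x + t • y)).hasFDerivAt.comp_hasDerivAt t h1

/-- Rescaling of an integral over a ball to the unit ball. -/
theorem setIntegral_ball_eq (g : E → ℝ) (x : E) {R : ℝ} (hR : 0 < R) :
    ∫ y in ball x R, g y =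
      R ^ Module.finrank ℝ E * ∫ y in ball (0 : E) 1, g (x + R • y) := by
  have h := Measure.setIntegral_comp_smul_of_pos (volume : Measure E) (fun y => g (x + y))
    (ball (0 : E) 1) hR
  rw [h, smul_unitBall_of_pos hR, smul_eq_mul, ← mul_assoc,
    mul_inv_cancel₀ (by positivity), one_mul]
  have h2 := (measurePreserving_add_left (volume : Measure E) x).setIntegral_preimage_emb
    (MeasurableEquiv.addLeft x).measurableEmbedding g (ball x R)
  rw [← h2]
  congr 2
  ext y; simp

/-- **Mean value inequality** for functions subharmonic on a ball, strict when `Δ g x > 0`. Outside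
the ball the compactly supported `g` is arbitrary, so that a singularity can be cut off there. -/
theorem le_setIntegral_ball_of_laplacian_nonneg {g : E → ℝ} (hg : ContDiff ℝ 2 g)
    (hc : HasCompactSupport g) {x : E} {R : ℝ} (hR : 0 < R)
    (hΔ : ∀ z ∈ closedBall x R, 0 ≤ Δ g z) :
    volume.real (ball x R) * g x ≤ ∫ y in ball x R, g y ∧
      (0 < Δ g x → volume.real (ball x R) * g x < ∫ y in ball x R, g y) := by
  have hg1 : ContDiff ℝ 1 g := hg.of_le (by norm_num)
  set A : ℝ → ℝ := fun r => ∫ y in ball (0 : E) 1, g (x + r • y) with hA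
  have hder := hasDerivAt_integral_ball hg1 hc x
  have hAc : ContinuousOn A (Icc 0 R) := fun r _ => (hder r).continuousAt.continuousWithinAt
  have hnn : ∀ r ∈ Ioo 0 R, ∀ y : E, 0 ≤ ballBump y * Δ g (x + r • y) := by
    intro r hr y
    rcases le_total 1 ‖y‖ with hy | hy
    · rw [ballBump_eq_zero hy, zero_mul]
    · refine mul_nonneg (ballBump_nonneg y) (hΔ _ ?_)
      rw [mem_closedBall, dist_eq_norm, add_sub_cancel_left, norm_smul, Real.norm_of_nonneg hr.1.le]
      nlinarith [hr.1, hr.2, norm_nonneg y]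
  have hA0 : A 0 = volume.real (ball (0 : E) 1) * g x := by simp [hA]
  have hvol : volume.real (ball x R) =
      R ^ Module.finrank ℝ E * volume.real (ball (0 : E) 1) := by
    rw [Measure.real, Measure.real, Measure.addHaar_ball_of_pos _ x hR, ENNReal.toReal_mul,
      ENNReal.toReal_ofReal (by positivity)]
  rw [setIntegral_ball_eq g x hR, hvol, mul_assoc, ← hA0]
  have hpos : 0 < R ^ Module.finrank ℝ E := by positivity
  constructor
  · refine mul_le_mul_of_nonneg_left ?_ hpos.le
    refine monotoneOn_of_deriv_nonneg (convex_Icc 0 R) hAc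
      (fun r _ => (hder r).differentiableAt.differentiableWithinAt) ?_
      (left_mem_Icc.2 hR.le) (right_mem_Icc.2 hR.le) hR.le
    intro r hr
    rw [interior_Icc] at hr
    rw [(hder r).deriv, integral_ball_fderiv_eq hg hc x hr.1]
    exact mul_nonneg hr.1.le (integral_nonneg (hnn r hr))
  · intro hx
    refine mul_lt_mul_of_pos_left ?_ hpos
    refine strictMonoOn_of_deriv_pos (convex_Icc 0 R) hAc ?_
      (left_mem_Icc.2 hR.le) (right_mem_Icc.2 hR.le) hR
    intro r hr
    rw [interior_Icc] at hr
    rw [(hder r).deriv, integral_ball_fderiv_eq hg hc x hr.1]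
    refine mul_pos hr.1 ?_
    have hcΔ : Continuous (Δ g) := by
      rw [InnerProductSpace.laplacian_eq_iteratedFDeriv_stdOrthonormalBasis]
      have := hg.continuous_iteratedFDeriv le_rfl
      fun_prop
    have hcs : HasCompactSupport (ballBump : E → ℝ) := by
      refine HasCompactSupport.intro (isCompact_closedBall (0 : E) 1) fun y hy => ?_
      rw [mem_closedBall_zero_iff, not_le] at hy
      exact ballBump_eq_zero hy.le
    refine Continuous.integral_pos_of_hasCompactSupport_nonneg_nonzero (x := 0) ?_ hcs.mul_right
      (hnn r hr) ?_
    · exact ballBump_lipschitz.continuous.mul (hcΔ.comp (by fun_prop))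
    · simp [ballBump, hx.ne']

end MeanValue

/-! ### Powers of the norm -/

section RadialPowers

open Metric
open scoped InnerProductSpace Laplacian

/-- A function of one variable can be changed away from a closed ball so as to have compact
support. -/
theorem exists_contDiff_hasCompactSupport_eqOn {G₀ : ℝ → ℝ} {c r R : ℝ} (hr : 0 < r) (hrR : r < R)
    (hG : ∀ s ∈ closedBall c R, ContDiffAt ℝ 2 G₀ s) :
    ∃ G : ℝ → ℝ, ContDiff ℝ 2 G ∧ HasCompactSupport G ∧
      EqOn G G₀ (closedBall c r) := by
  let φ : ContDiffBump c := ⟨r, R, hr, hrR⟩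
  refine ⟨fun s => φ s * G₀ s, ?_, φ.hasCompactSupport.mul_right, fun s hs => ?_⟩
  · refine contDiff_iff_contDiffAt.2 fun s => ?_
    by_cases hs : s ∈ closedBall c R
    · exact φ.contDiffAt.mul (hG s hs)
    · refine (contDiffAt_const (c := (0 : ℝ))).congr_of_eventuallyEq ?_
      filter_upwards [isClosed_closedBall.isOpen_compl.mem_nhds hs] with t ht
      have : φ t = 0 := φ.zero_of_le_dist (not_le.1 fun h => ht h).le
      simp [this]
  · simp [φ.one_of_mem_closedBall hs]

theorem hasDerivAt_add_rpow (κ β : ℝ) {s : ℝ} (hs : 0 < κ + s) :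
    HasDerivAt (fun s : ℝ => (κ + s) ^ (-β)) (-β * (κ + s) ^ (-β - 1)) s := by
  have := ((hasDerivAt_id s).const_add κ).rpow_const (p := -β) (Or.inl hs.ne')
  simpa using this

variable {E : Type*} [NormedAddCommGroup E] [InnerProductSpace ℝ E] [FiniteDimensional ℝ E]

theorem laplacian_radial_rpow {G : ℝ → ℝ} (hG : ContDiff ℝ 2 G) {κ β : ℝ} {z : E}
    (hz : 0 < κ + ‖z‖ ^ 2) (h : G =ᶠ[𝓝 (‖z‖ ^ 2)] fun s => (κ + s) ^ (-β)) :
    Δ (fun y : E => G (‖y‖ ^ 2)) z = 2 * β * (κ + ‖z‖ ^ 2) ^ (-β - 2) *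
      (‖z‖ ^ 2 * (2 * β + 2 - Module.finrank ℝ E) - Module.finrank ℝ E * κ) := by
  set s := ‖z‖ ^ 2 with hs
  have hev : ∀ᶠ t in 𝓝 s, 0 < κ + t :=
    (continuous_const.add continuous_id).continuousAt.eventually_const_lt hz
  have h1 : deriv G =ᶠ[𝓝 s] fun t => -β * (κ + t) ^ (-(β + 1)) := by
    filter_upwards [h.eventuallyEq_nhds, hev] with t ht ht'
    rw [ht.deriv_eq, (hasDerivAt_add_rpow κ β ht').deriv]
    ring_nf
  have h2 : deriv (deriv G) s = β * (β + 1) * (κ + s) ^ (-β - 2) := by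
    rw [h1.deriv_eq, ((hasDerivAt_add_rpow κ (β + 1) hz).const_mul (-β)).deriv]
    ring_nf
  have h3 : (κ + s) ^ (-(β + 1)) = (κ + s) ^ (-β - 2) * (κ + s) := by
    rw [← Real.rpow_add_one hz.ne']
    ring_nf
  rw [laplacian_radial hG, h1.eq_of_nhds, h2, h3]
  ring

variable [MeasurableSpace E] [BorelSpace E]

/-- The function `(1 + ‖y‖²)^((2 - d)/2)` is superharmonic in dimension `d`. -/
theorem setIntegral_ball_one_add_sq_rpow_le {β : ℝ} (hβ : 2 * β + 2 = Module.finrank ℝ E)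
    (hβ0 : 0 ≤ β) (x : E) {R : ℝ} (hR : 0 < R) :
    ∫ y in ball x R, (1 + ‖y‖ ^ 2) ^ (-β) ≤ volume.real (ball x R) * (1 + ‖x‖ ^ 2) ^ (-β) := by
  set S := (‖x‖ + R) ^ 2 with hS
  -- The cut-off takes place in the variable `s = ‖y‖²`; the interval used contains `[0, S]` and
  -- stays away from the singularity `s = -1`.
  have hS0 : 0 < S := by positivity
  obtain ⟨G, hG, hGc, hGe⟩ := exists_contDiff_hasCompactSupport_eqOn
    (G₀ := fun s : ℝ => (1 + s) ^ (-β)) (c := S) (r := S + 1 / 4) (R := S + 1 / 2)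
    (by positivity) (by linarith) (fun s hs => by
      rw [mem_closedBall, Real.dist_eq, abs_le] at hs
      exact (contDiffAt_const.add contDiffAt_id).rpow_const_of_ne
        (show (1 : ℝ) + s ≠ 0 by linarith))
  have hmem : ∀ z ∈ closedBall x R, ‖z‖ ^ 2 ∈ ball S (S + 1 / 4) := by
    intro z hz
    have h1 : ‖z‖ ≤ ‖x‖ + R := norm_le_of_mem_closedBall hz
    have h2 : ‖z‖ ^ 2 ≤ S := by rw [hS]; gcongr
    rw [mem_ball, Real.dist_eq, abs_lt]
    constructor <;> nlinarith [sq_nonneg ‖z‖]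
  set g : E → ℝ := fun y => -G (‖y‖ ^ 2) with hg
  have hg2 : ContDiff ℝ 2 g := (hG.comp (contDiff_norm_sq ℝ)).neg
  have hgc : HasCompactSupport g := by
    obtain ⟨M, hM⟩ := hGc.isCompact.isBounded.subset_closedBall 0
    refine HasCompactSupport.intro (isCompact_closedBall (0 : E) (M + 1)) fun y hy => ?_
    rw [mem_closedBall_zero_iff, not_le] at hy
    rw [hg, neg_eq_zero]
    refine image_eq_zero_of_notMem_tsupport fun hc => ?_
    have := hM hc
    rw [mem_closedBall_zero_iff, Real.norm_of_nonneg (by positivity)] at this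
    nlinarith [norm_nonneg y, sq_nonneg (‖y‖ - 1)]
  have hge : ∀ z ∈ closedBall x R, g z = -(1 + ‖z‖ ^ 2) ^ (-β) := fun z hz => by
    simpa [hg] using hGe (ball_subset_closedBall (hmem z hz))
  have key := (le_setIntegral_ball_of_laplacian_nonneg hg2 hgc (x := x) hR fun z hz => ?_).1
  · rw [hge x (mem_closedBall_self hR.le), setIntegral_congr_fun measurableSet_ball
      (fun z hz => hge z (ball_subset_closedBall hz)), integral_neg] at key
    linarith
  · have e : g = -fun y : E => G (‖y‖ ^ 2) := rfl
    rw [e, InnerProductSpace.laplacian_neg, Pi.neg_apply, laplacian_radial_rpow hG (κ := 1) (β := β)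
      (by positivity), ← hβ]
    · have : 0 ≤ (1 + ‖z‖ ^ 2) ^ (-β - 2) := by positivity
      have h3 : 0 ≤ β * (1 + ‖z‖ ^ 2) ^ (-β - 2) * (2 * β + 2) := by positivity
      linarith
    · filter_upwards [isOpen_ball.mem_nhds (hmem z hz)] with s hs
      exact hGe (ball_subset_closedBall hs)

/-- The power `‖y‖^(-2β)` with `2β > d - 2` is strictly subharmonic away from the origin, in
dimension `d`. -/
theorem eventually_lt_setIntegral_ball_sq_rpow {β : ℝ} (hβ : (Module.finrank ℝ E : ℝ) < 2 * β + 2)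
    (hβ0 : 0 < β) {x : E} (hx : x ≠ 0) :
    ∀ᶠ r in 𝓝[>] (0 : ℝ),
      volume.real (ball x r) * (‖x‖ ^ 2) ^ (-β) < ∫ y in ball x r, (‖y‖ ^ 2) ^ (-β) := by
  set S := ‖x‖ ^ 2 with hS
  have hS0 : 0 < S := by positivity
  obtain ⟨G, hG, hGc, hGe⟩ := exists_contDiff_hasCompactSupport_eqOn
    (G₀ := fun s : ℝ => (0 + s) ^ (-β)) (c := S) (r := S / 4) (R := S / 2)
    (by positivity) (by linarith) (fun s hs => by
      rw [mem_closedBall, Real.dist_eq, abs_le] at hs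
      exact (contDiffAt_const.add contDiffAt_id).rpow_const_of_ne
        (show (0 : ℝ) + s ≠ 0 by linarith))
  set g : E → ℝ := fun y => G (‖y‖ ^ 2) with hg
  have hg2 : ContDiff ℝ 2 g := hG.comp (contDiff_norm_sq ℝ)
  have hgc : HasCompactSupport g := by
    obtain ⟨M, hM⟩ := hGc.isCompact.isBounded.subset_closedBall 0
    refine HasCompactSupport.intro (isCompact_closedBall (0 : E) (M + 1)) fun y hy => ?_
    rw [mem_closedBall_zero_iff, not_le] at hy
    refine image_eq_zero_of_notMem_tsupport (f := G) fun hc => ?_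
    have := hM hc
    rw [mem_closedBall_zero_iff, Real.norm_of_nonneg (by positivity)] at this
    nlinarith [norm_nonneg y, sq_nonneg (‖y‖ - 1)]
  have hcont : ContinuousAt (fun z : E => ‖z‖ ^ 2) x := by fun_prop
  obtain ⟨ε, hε, hball⟩ := nhds_basis_closedBall.mem_iff.1
    (hcont.preimage_mem_nhds (ball_mem_nhds S (show 0 < S / 4 by positivity)))
  filter_upwards [Ioo_mem_nhdsGT hε] with r hr
  have hmem : ∀ z ∈ closedBall x r, ‖z‖ ^ 2 ∈ ball S (S / 4) := fun z hz =>
    hball (closedBall_subset_closedBall hr.2.le hz)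
  have hge : ∀ z ∈ closedBall x r, g z = (‖z‖ ^ 2) ^ (-β) := fun z hz => by
    simpa using hGe (ball_subset_closedBall (hmem z hz))
  have hlap : ∀ z ∈ closedBall x r, 0 < Δ g z := by
    intro z hz
    have hz' := hmem z hz
    rw [mem_ball, Real.dist_eq, abs_lt] at hz'
    have hz0 : 0 < ‖z‖ ^ 2 := by linarith
    rw [hg, laplacian_radial_rpow hG (κ := 0) (β := β) (by linarith)]
    · have h1 : 0 < 2 * β + 2 - Module.finrank ℝ E := by linarith
      rw [zero_add, mul_zero, sub_zero]
      positivity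
    · filter_upwards [isOpen_ball.mem_nhds (hmem z hz)] with s hs
      exact hGe (ball_subset_closedBall hs)
  have key := (le_setIntegral_ball_of_laplacian_nonneg hg2 hgc (x := x) hr.1
    fun z hz => (hlap z hz).le).2 (hlap x (mem_closedBall_self hr.1.le))
  rwa [hge x (mem_closedBall_self hr.1.le), setIntegral_congr_fun measurableSet_ball
    (fun z hz => hge z (ball_subset_closedBall hz))] at key

end RadialPowers

/-! ### Comparison for functions that dominate their ball averages -/

section Comparison

open Metric

variable {E : Type*} [NormedAddCommGroup E] [InnerProductSpace ℝ E] [FiniteDimensional ℝ E]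
  [MeasurableSpace E] [BorelSpace E]

/-- `g` is continuous, nonnegative, and nowhere below its average over a ball centred there:
a nonnegative superharmonic function. -/
structure IsSuperMean (g : E → ℝ) : Prop where
  continuous : Continuous g
  nonneg : ∀ x, 0 ≤ g x
  setIntegral_ball_le : ∀ x r, 0 < r → ∫ y in ball x r, g y ≤ volume.real (ball x r) * g x

theorem IsSuperMean.comp_add_right {g : E → ℝ} (hg : IsSuperMean g) (a : E) :
    IsSuperMean fun x => g (x + a) where
  continuous := hg.continuous.comp (by fun_prop)
  nonneg x := hg.nonneg _
  setIntegral_ball_le x r hr := by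
    have h := hg.setIntegral_ball_le (x + a) r hr
    rw [setIntegral_ball_eq _ _ hr] at h ⊢
    rw [Measure.real, Measure.addHaar_ball_center, ← Measure.real] at h ⊢
    simpa [add_right_comm] using h

/-- Minimum principle: near an interior minimum of `g - c b`, where `b = ‖y‖^(-2β)` is strictly
subharmonic, the averages of `g` would exceed the value of `g` at the centre. -/
theorem IsSuperMean.not_isLocalMin_sub {g : E → ℝ} (hg : IsSuperMean g) {β c : ℝ}
    (hβ : (Module.finrank ℝ E : ℝ) < 2 * β + 2) (hβ0 : 0 < β) (hc : 0 < c) {x : E} (hx : x ≠ 0) :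
    ¬ IsLocalMin (fun y => g y - c * (‖y‖ ^ 2) ^ (-β)) x := by
  intro hmin
  obtain ⟨ε, hε, hball⟩ := nhds_basis_closedBall.mem_iff.1
    (hmin.and (isOpen_ne.mem_nhds hx : ∀ᶠ y in 𝓝 x, y ≠ 0))
  obtain ⟨r, hlt, hr⟩ := ((eventually_lt_setIntegral_ball_sq_rpow hβ hβ0 hx).and
    (Ioo_mem_nhdsGT hε)).exists
  have hsub : closedBall x r ⊆ closedBall x ε := closedBall_subset_closedBall hr.2.le
  have hbc : ContinuousOn (fun y : E => (‖y‖ ^ 2) ^ (-β)) (closedBall x r) := fun y hy => by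
    have : ‖y‖ ^ 2 ≠ 0 := by simpa using (hball (hsub hy)).2
    have h2 : ContinuousAt (fun z : E => ‖z‖ ^ 2) y := by fun_prop
    exact (h2.rpow_const (Or.inl this)).continuousWithinAt
  have hbi : IntegrableOn (fun y : E => (‖y‖ ^ 2) ^ (-β)) (ball x r) :=
    (hbc.integrableOn_compact (isCompact_closedBall x r)).mono_set ball_subset_closedBall
  have hgi : IntegrableOn g (ball x r) :=
    (hg.continuous.continuousOn.integrableOn_compact (isCompact_closedBall x r)).mono_set
      ball_subset_closedBall
  have hmono : ∫ y in ball x r, (g x - c * (‖x‖ ^ 2) ^ (-β)) ≤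
      ∫ y in ball x r, (g y - c * (‖y‖ ^ 2) ^ (-β)) := by
    refine setIntegral_mono_on (integrableOn_const measure_ball_lt_top.ne)
      (hgi.sub (hbi.const_mul c)) measurableSet_ball fun y hy => ?_
    exact (hball (hsub (ball_subset_closedBall hy))).1
  rw [setIntegral_const, integral_sub hgi (hbi.const_mul c), integral_const_mul, smul_eq_mul]
    at hmono
  have h1 := hg.setIntegral_ball_le x r hr.1
  have h2 := mul_lt_mul_of_pos_left hlt hc
  linarith

/-- Comparison with `‖y‖^(-2β)` on annuli around the origin whose outer radius tends to `∞`. -/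
theorem IsSuperMean.mul_sq_rpow_le {g : E → ℝ} (hg : IsSuperMean g) {β m ρ : ℝ}
    (hβ : (Module.finrank ℝ E : ℝ) < 2 * β + 2) (hβ0 : 0 < β) (hm : 0 ≤ m) (hρ : 0 < ρ)
    (hgm : ∀ y, ‖y‖ ≤ ρ → m ≤ g y) {x : E} (hx : ρ ≤ ‖x‖) :
    m * (ρ ^ 2 / ‖x‖ ^ 2) ^ β ≤ g x := by
  rcases hm.eq_or_lt with rfl | hm
  · simpa using hg.nonneg x
  set c := m * (ρ ^ 2) ^ β with hc
  have hc0 : 0 < c := by positivity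
  have hx0 : 0 < ‖x‖ := hρ.trans_le hx
  have key : ∀ R, ‖x‖ ≤ R → c * (‖x‖ ^ 2) ^ (-β) - c * (R ^ 2) ^ (-β) ≤ g x := by
    intro R hR
    have hR0 : 0 < R := hx0.trans_le hR
    set K : Set E := {y | ρ ≤ ‖y‖ ∧ ‖y‖ ≤ R} with hK
    have hKc : IsCompact K := by
      refine (isCompact_closedBall (0 : E) R).of_isClosed_subset ?_ fun y hy => by
        simpa using hy.2
      exact (isClosed_le continuous_const continuous_norm).inter
        (isClosed_le continuous_norm continuous_const)
    set h : E → ℝ := fun y => g y - c * (‖y‖ ^ 2) ^ (-β) with hh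
    have hcont : ContinuousOn h K := fun y hy => by
      have : ‖y‖ ^ 2 ≠ 0 := by have := hρ.trans_le hy.1; positivity
      have h2 : ContinuousAt (fun z : E => ‖z‖ ^ 2) y := by fun_prop
      exact (hg.continuous.continuousAt.sub (continuousAt_const.mul
        (h2.rpow_const (Or.inl this)))).continuousWithinAt
    obtain ⟨y, hy, hmin⟩ := hKc.exists_isMinOn ⟨x, hx, hR⟩ hcont
    have hhx : h y ≤ h x := hmin ⟨hx, hR⟩
    suffices -(c * (R ^ 2) ^ (-β)) ≤ h y by
      simp only [hh] at hhx this ⊢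
      linarith
    -- On both boundary spheres the bound holds by construction, and the interior is excluded.
    rcases hy.1.eq_or_lt with h1 | h1
    · have e : c * (‖y‖ ^ 2) ^ (-β) = m := by
        rw [← h1, hc, mul_assoc, ← Real.rpow_add (by positivity)]
        simp
      have : 0 ≤ c * (R ^ 2) ^ (-β) := by positivity
      have := hgm y h1.symm.le
      simp only [hh]
      linarith
    rcases hy.2.eq_or_lt with h2 | h2
    · simp only [hh, h2]
      linarith [hg.nonneg y]
    exfalso
    refine hg.not_isLocalMin_sub hβ hβ0 hc0 (norm_pos_iff.1 (hρ.trans h1)) ?_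
    refine hmin.isLocalMin ?_
    filter_upwards [continuous_norm.continuousAt.eventually_const_lt h1,
      continuous_norm.continuousAt.eventually_lt_const h2] with z hz1 hz2
    exact ⟨hz1.le, hz2.le⟩
  have hlim : Tendsto (fun R : ℝ => c * (‖x‖ ^ 2) ^ (-β) - c * (R ^ 2) ^ (-β)) atTop
      (𝓝 (c * (‖x‖ ^ 2) ^ (-β) - c * 0)) :=
    tendsto_const_nhds.sub (((tendsto_rpow_neg_atTop hβ0).comp
      (tendsto_pow_atTop two_ne_zero)).const_mul c)
  have := le_of_tendsto hlim (eventually_atTop.2 ⟨‖x‖, key⟩)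
  rwa [mul_zero, sub_zero, hc, mul_assoc, Real.rpow_neg (by positivity), ← div_eq_mul_inv,
    ← Real.div_rpow (by positivity) (by positivity)] at this

/-- The comparison persists for the limiting exponent `2β = max (d - 2) 0`. -/
theorem IsSuperMean.mul_sq_rpow_le' {g : E → ℝ} (hg : IsSuperMean g) {β m ρ : ℝ}
    (hβ : (Module.finrank ℝ E : ℝ) ≤ 2 * β + 2) (hβ0 : 0 ≤ β) (hm : 0 ≤ m) (hρ : 0 < ρ)
    (hgm : ∀ y, ‖y‖ ≤ ρ → m ≤ g y) {x : E} (hx : ρ ≤ ‖x‖) :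
    m * (ρ ^ 2 / ‖x‖ ^ 2) ^ β ≤ g x := by
  have hx0 : 0 < ‖x‖ := hρ.trans_le hx
  have hq : ρ ^ 2 / ‖x‖ ^ 2 ≠ 0 := by positivity
  have hlim : Tendsto (fun γ : ℝ => m * (ρ ^ 2 / ‖x‖ ^ 2) ^ γ) (𝓝[>] β)
      (𝓝 (m * (ρ ^ 2 / ‖x‖ ^ 2) ^ β)) :=
    ((Real.continuous_const_rpow hq).tendsto β).const_mul m |>.mono_left nhdsWithin_le_nhds
  refine le_of_tendsto hlim ?_
  filter_upwards [self_mem_nhdsWithin] with γ hγ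
  rw [mem_Ioi] at hγ
  exact hg.mul_sq_rpow_le (by linarith) (by linarith) hm hρ hgm hx

/-- In dimension at most `2` the limiting exponent is `0`: the minimum of `g` over a small ball around
`a` bounds `g` from below everywhere. -/
theorem IsSuperMean.eq_of_finrank_le_two {g : E → ℝ} (hg : IsSuperMean g)
    (hd : Module.finrank ℝ E ≤ 2) (x a : E) : g x = g a := by
  have key : ∀ x a : E, g a ≤ g x := by
    intro x a
    rcases eq_or_ne x a with rfl | hxa
    · exact le_rfl
    refine le_of_forall_pos_sub_le fun ε hε => ?_
    obtain ⟨δ, hδ, hball⟩ := Metric.continuousAt_iff.1 (hg.continuous.continuousAt (x := a)) ε hε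
    have hxa0 : 0 < ‖x - a‖ := norm_pos_iff.2 (sub_ne_zero.2 hxa)
    set ρ := min (δ / 2) ‖x - a‖ with hρ
    have hρ0 : 0 < ρ := by positivity
    rcases le_total (g a - ε) 0 with h0 | h0
    · exact h0.trans (hg.nonneg x)
    have := (hg.comp_add_right a).mul_sq_rpow_le' (β := 0) (m := g a - ε) (ρ := ρ) (x := x - a)
      (by simpa using (by exact_mod_cast hd : (Module.finrank ℝ E : ℝ) ≤ 2)) le_rfl h0 hρ0 ?_ (min_le_right _ _)
    · simpa using this
    · intro y hy
      have h1 : dist (y + a) a < δ := by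
        rw [dist_eq_norm, add_sub_cancel_right]
        linarith [min_le_left (δ / 2) ‖x - a‖]
      have h2 := hball h1
      rw [Real.dist_eq, abs_lt] at h2
      linarith
  exact le_antisymm (key a x) (key x a)

/-- In dimension `d ≥ 2`, a positive superharmonic function decays no faster than
`‖x‖^(2 - d)`. -/
theorem IsSuperMean.exists_mul_one_add_sq_rpow_le {g : E → ℝ} (hg : IsSuperMean g)
    (hpos : ∀ x, 0 < g x) {β : ℝ} (hβ : (Module.finrank ℝ E : ℝ) ≤ 2 * β + 2) (hβ0 : 0 ≤ β) :
    ∃ c, 0 < c ∧ ∀ x, c * (1 + ‖x‖ ^ 2) ^ (-β) ≤ g x := by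
  obtain ⟨y, -, hy⟩ := (isCompact_closedBall (0 : E) 1).exists_isMinOn
    ⟨0, mem_closedBall_self zero_le_one⟩ hg.continuous.continuousOn
  refine ⟨g y, hpos y, fun x => ?_⟩
  have hm : ∀ z, ‖z‖ ≤ 1 → g y ≤ g z := fun z hz => hy (mem_closedBall_zero_iff.2 hz)
  rcases le_total ‖x‖ 1 with hx | hx
  · refine le_trans ?_ (hm x hx)
    refine mul_le_of_le_one_right (hpos y).le ?_
    exact Real.rpow_le_one_of_one_le_of_nonpos (by nlinarith [sq_nonneg ‖x‖]) (by linarith)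
  · refine le_trans ?_ (hg.mul_sq_rpow_le' hβ hβ0 (hpos y).le one_pos hm hx)
    refine mul_le_mul_of_nonneg_left ?_ (hpos y).le
    have hx0 : 0 < ‖x‖ := by linarith
    rw [one_pow, one_div, Real.inv_rpow (by positivity), ← Real.rpow_neg (by positivity)]
    exact Real.rpow_le_rpow_of_nonpos (by positivity) (by linarith) (by linarith)

end Comparison

/-! ### Averages over balls of a fixed radius -/

section BallIntegrals

open Metric

variable {E : Type*} [NormedAddCommGroup E] [InnerProductSpace ℝ E] [FiniteDimensional ℝ E]
  [MeasurableSpace E] [BorelSpace E]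

theorem setLIntegral_ball_add (F : E → ℝ≥0∞) (a b : E) (r : ℝ) :
    ∫⁻ z in ball (a + b) r, F z = ∫⁻ z in ball a r, F (z + b) := by
  have h2 := (measurePreserving_add_right (volume : Measure E) b).setLIntegral_comp_preimage_emb
    (MeasurableEquiv.addRight b).measurableEmbedding F (ball (a + b) r)
  rw [← h2]
  congr 2
  ext y; simp

/-- Averaging a locally integrable function that dominates its ball averages almost everywhere
gives a continuous function that dominates its ball averages everywhere. -/
theorem isSuperMean_setLIntegral_ball {F : E → ℝ≥0∞} (hF : Measurable F)
    (hfin : ∀ x r, ∫⁻ y in ball x r, F y < ∞)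
    (h : ∀ᵐ x, ∀ r, 0 < r → ∫⁻ y in ball x r, F y ≤ volume (ball x r) * F x)
    {δ : ℝ} (hδ : 0 < δ) :
    IsSuperMean fun x : E => (∫⁻ y in ball x δ, F y).toReal := by
  have hcont : Continuous fun x : E => ∫⁻ y in ball x δ, F y := by
    refine continuous_iff_continuousAt.2 fun x => ?_
    simp_rw [ContinuousAt, ← lintegral_indicator measurableSet_ball]
    refine tendsto_lintegral_filter_of_dominated_convergence
      ((ball x (2 * δ)).indicator F) ?_ ?_ ?_ ?_
    · exact Eventually.of_forall fun z => hF.indicator measurableSet_ball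
    · filter_upwards [ball_mem_nhds x hδ] with z hz
      refine Eventually.of_forall fun y => ?_
      refine indicator_le_indicator_of_subset (fun y hy => ?_) (fun _ => zero_le) y
      rw [mem_ball] at *
      linarith [dist_triangle y z x]
    · rw [lintegral_indicator measurableSet_ball]
      exact (hfin x _).ne
    · have : ∀ᵐ y : E, y ∉ sphere x δ :=
        measure_eq_zero_iff_ae_notMem.1 (Measure.addHaar_sphere_of_ne_zero _ x hδ.ne')
      filter_upwards [this] with y hy
      refine tendsto_const_nhds.congr' ?_
      have hc : ContinuousAt (fun z : E => dist y z) x := by fun_prop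
      rcases lt_or_gt_of_ne (mt mem_sphere.2 hy) with h1 | h1
      · filter_upwards [hc.eventually_lt_const h1] with z hz
        rw [indicator_of_mem (mem_ball.2 h1), indicator_of_mem (mem_ball.2 hz)]
      · filter_upwards [hc.eventually_const_lt h1] with z hz
        rw [indicator_of_notMem (fun h => (mem_ball.1 h).not_gt h1),
          indicator_of_notMem (fun h => (mem_ball.1 h).not_gt hz)]
  have hcr : Continuous fun x : E => (∫⁻ y in ball x δ, F y).toReal :=
    continuous_iff_continuousAt.2 fun x =>
      (ENNReal.tendsto_toReal (hfin x δ).ne).comp hcont.continuousAt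
  refine ⟨hcr, fun x => ENNReal.toReal_nonneg, fun x r hr => ?_⟩
  have key : ∫⁻ y in ball x r, ∫⁻ z in ball y δ, F z ≤
      volume (ball x r) * ∫⁻ z in ball x δ, F z := by
    calc ∫⁻ y in ball x r, ∫⁻ z in ball y δ, F z
        = ∫⁻ y in ball x r, ∫⁻ z in ball (0 : E) δ, F (z + y) := by
          congr 1; ext y
          rw [← setLIntegral_ball_add, zero_add]
      _ = ∫⁻ z in ball (0 : E) δ, ∫⁻ y in ball x r, F (z + y) := by
          refine lintegral_lintegral_swap ?_
          exact (hF.comp (measurable_snd.add measurable_fst)).aemeasurable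
      _ ≤ ∫⁻ z in ball (0 : E) δ, volume (ball x r) * F (z + x) := by
          refine lintegral_mono_ae (ae_restrict_of_ae ?_)
          filter_upwards [(measurePreserving_add_right (volume : Measure E)
            x).quasiMeasurePreserving.ae h] with z hz
          have h1 := hz r hr
          rw [add_comm z x, setLIntegral_ball_add] at h1
          rw [Measure.addHaar_ball_center] at h1 ⊢
          simpa only [add_comm] using h1
      _ = volume (ball x r) * ∫⁻ z in ball x δ, F z := by
          rw [lintegral_const_mul _ (by fun_prop), ← setLIntegral_ball_add, zero_add]
  rw [integral_toReal hcont.measurable.aemeasurable.restrict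
    (Eventually.of_forall fun y => hfin y δ), Measure.real, ← ENNReal.toReal_mul]
  exact ENNReal.toReal_mono (ENNReal.mul_ne_top measure_ball_lt_top.ne (hfin x δ).ne) key

end BallIntegrals

/-! ### Fixed points of the maximal function -/

section FixedPoints

open Metric

variable {n : ℕ}

/-- The superharmonic function `(1 + ‖x‖²)^((2 - n)/2)`. -/
noncomputable def superharmonicBump (n : ℕ) (x : EuclideanSpace ℝ (Fin n)) : ℝ :=
  (1 + ‖x‖ ^ 2) ^ (-(((n : ℝ) - 2) / 2))

theorem superharmonicBump_pos (x : EuclideanSpace ℝ (Fin n)) : 0 < superharmonicBump n x := by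
  unfold superharmonicBump; positivity

theorem continuous_superharmonicBump : Continuous (superharmonicBump n) :=
  (by fun_prop : Continuous fun x : EuclideanSpace ℝ (Fin n) => 1 + ‖x‖ ^ 2).rpow_const
    fun x => Or.inl (by positivity)

theorem isMaximalFixedPoint_superharmonicBump (hn : 2 ≤ n) :
    IsMaximalFixedPoint (superharmonicBump n) := by
  have hn' : (2 : ℝ) ≤ n := by exact_mod_cast hn
  refine ⟨continuous_superharmonicBump.locallyIntegrable, Eventually.of_forall fun x =>
    ⟨(superharmonicBump_pos x).le, le_antisymm ?_ ?_⟩⟩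
  · refine iSup₂_le fun r hr => ?_
    have hv0 : volume (ball x r) ≠ 0 := (measure_ball_pos _ _ hr).ne'
    have hvt : volume (ball x r) ≠ ∞ := measure_ball_lt_top.ne
    have h1 : ∫⁻ y in ball x r, ‖superharmonicBump n y‖ₑ =
        ENNReal.ofReal (∫ y in ball x r, superharmonicBump n y) := by
      rw [ofReal_integral_eq_lintegral_ofReal]
      · simp_rw [Real.enorm_of_nonneg (superharmonicBump_pos _).le]
      · exact (continuous_superharmonicBump.continuousOn.integrableOn_compact
          (isCompact_closedBall x r)).mono_set ball_subset_closedBall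
      · exact Eventually.of_forall fun y => (superharmonicBump_pos y).le
    have h2 := setIntegral_ball_one_add_sq_rpow_le (E := EuclideanSpace ℝ (Fin n))
      (β := ((n : ℝ) - 2) / 2) (by rw [finrank_euclideanSpace_fin]; ring) (by linarith) x hr
    calc (volume (ball x r))⁻¹ * ∫⁻ y in ball x r, ‖superharmonicBump n y‖ₑ
        ≤ (volume (ball x r))⁻¹ * (volume (ball x r) * ENNReal.ofReal (superharmonicBump n x)) := by
          rw [h1]
          gcongr
          calc _ ≤ ENNReal.ofReal (volume.real (ball x r) * superharmonicBump n x) :=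
                ENNReal.ofReal_le_ofReal h2
            _ = _ := by
                rw [ENNReal.ofReal_mul measureReal_nonneg, Measure.real, ENNReal.ofReal_toReal hvt]
      _ = ENNReal.ofReal (superharmonicBump n x) := by
          rw [← mul_assoc, ENNReal.inv_mul_cancel hv0 hvt, one_mul]
  · refine le_of_forall_lt fun c hc => ?_
    obtain ⟨c', hc', hc''⟩ := exists_between hc
    refine hc'.trans_le ?_
    have hcont : Continuous fun y => ENNReal.ofReal (superharmonicBump n y) :=
      ENNReal.continuous_ofReal.comp continuous_superharmonicBump
    obtain ⟨r, hr, hball⟩ := Metric.mem_nhds_iff.1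
      (hcont.continuousAt.eventually_const_lt hc'')
    have hv0 : volume (ball x r) ≠ 0 := (measure_ball_pos _ _ hr).ne'
    have hvt : volume (ball x r) ≠ ∞ := measure_ball_lt_top.ne
    refine le_iSup₂_of_le r hr ?_
    calc c' = (volume (ball x r))⁻¹ * ∫⁻ y in ball x r, c' := by
          rw [setLIntegral_const, mul_comm c', ← mul_assoc, ENNReal.inv_mul_cancel hv0 hvt, one_mul]
      _ ≤ _ := by
          gcongr (volume (ball x r))⁻¹ * ?_
          refine setLIntegral_mono' measurableSet_ball fun y hy => ?_
          rw [Real.enorm_of_nonneg (superharmonicBump_pos _).le]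
          exact (hball hy).le

theorem isNonconstant_superharmonicBump (hn : 3 ≤ n) : IsNonconstant (superharmonicBump n) := by
  rintro ⟨c, hc⟩
  have h := continuous_superharmonicBump.ae_eq_iff_eq volume continuous_const |>.1 hc
  have hn' : (3 : ℝ) ≤ n := by exact_mod_cast hn
  have h0 := congrFun h 0
  have h1 := congrFun h (EuclideanSpace.single ⟨0, by omega⟩ 1)
  have hlt : (2 : ℝ) ^ (-(((n : ℝ) - 2) / 2)) < 1 :=
    Real.rpow_lt_one_of_one_lt_of_neg one_lt_two (by linarith)
  norm_num [superharmonicBump] at h0 h1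
  linarith

/-- A measurable version `F` of `‖f‖ₑ` for a fixed point `f`, whose ball averages it dominates. -/
theorem IsMaximalFixedPoint.exists_measurable {f : EuclideanSpace ℝ (Fin n) → ℝ}
    (hf : IsMaximalFixedPoint f) :
    ∃ F : EuclideanSpace ℝ (Fin n) → ℝ≥0∞, Measurable F ∧ (∀ᵐ x, F x = ENNReal.ofReal (f x)) ∧
      (∀ x r, ∫⁻ y in ball x r, ‖f y‖ₑ = ∫⁻ y in ball x r, F y) ∧
      (∀ x r, ∫⁻ y in ball x r, F y < ∞) ∧
      ∀ᵐ x, ∀ r, 0 < r → ∫⁻ y in ball x r, F y ≤ volume (ball x r) * F x := by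
  obtain ⟨hli, hae⟩ := hf
  have hm : AEMeasurable (fun x => ‖f x‖ₑ) := hli.aestronglyMeasurable.enorm
  have heq : ∀ x r, ∫⁻ y in ball x r, ‖f y‖ₑ = ∫⁻ y in ball x r, hm.mk _ y := fun x r =>
    lintegral_congr_ae (ae_restrict_of_ae hm.ae_eq_mk)
  refine ⟨hm.mk _, hm.measurable_mk, ?_, heq, fun x r => ?_, ?_⟩
  · filter_upwards [hm.ae_eq_mk, hae] with x hx hx2
    rw [← hx, Real.enorm_of_nonneg hx2.1]
  · rw [← heq]
    exact ((hli.integrableOn_isCompact (isCompact_closedBall x r)).mono_set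
      ball_subset_closedBall).hasFiniteIntegral
  · filter_upwards [hm.ae_eq_mk, hae] with x hx hx2 r hr
    rw [← heq, ← hx, Real.enorm_of_nonneg hx2.1, ← hx2.2]
    have hv0 : volume (ball x r) ≠ 0 := (measure_ball_pos _ _ hr).ne'
    have hvt : volume (ball x r) ≠ ∞ := measure_ball_lt_top.ne
    calc ∫⁻ y in ball x r, ‖f y‖ₑ
        = volume (ball x r) * ((volume (ball x r))⁻¹ * ∫⁻ y in ball x r, ‖f y‖ₑ) := by
          rw [← mul_assoc, ENNReal.mul_inv_cancel hv0 hvt, one_mul]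
      _ ≤ _ := by
          gcongr
          exact le_iSup₂_of_le r hr le_rfl

/-- In dimensions at most `2` the ball averages of a fixed point do not depend on the centre, and
`f` is their supremum over the radii. -/
theorem IsMaximalFixedPoint.not_isNonconstant {f : EuclideanSpace ℝ (Fin n) → ℝ}
    (hf : IsMaximalFixedPoint f) (hn : n ≤ 2) : ¬ IsNonconstant f := by
  obtain ⟨F, hF, hFf, heq, hfin, hsup⟩ := hf.exists_measurable
  have hM : ∀ x, hlMaximal f x = hlMaximal f 0 := by
    intro x
    refine iSup_congr fun r => iSup_congr fun hr => ?_
    have h := (isSuperMean_setLIntegral_ball hF hfin hsup hr).eq_of_finrank_le_two (by simpa) x 0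
    rw [heq, heq, Measure.addHaar_ball_center, (ENNReal.toReal_eq_toReal_iff' (hfin x r).ne
      (hfin 0 r).ne).1 h]
  rw [IsNonconstant, not_not]
  refine ⟨(hlMaximal f 0).toReal, ?_⟩
  filter_upwards [hf.2] with x hx
  rw [← hM x, hx.2, ENNReal.toReal_ofReal hx.1]

/-- A nonconstant fixed point is positive almost everywhere, and so are its averages over unit
balls, which it dominates and to which the comparison with the bump applies. -/
theorem IsMaximalFixedPoint.exists_mul_superharmonicBump_le {f : EuclideanSpace ℝ (Fin n) → ℝ}
    (hf : IsMaximalFixedPoint f) (hc : IsNonconstant f) (hn : 2 ≤ n) :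
    ∃ c, 0 < c ∧ ∀ᵐ x, c * superharmonicBump n x ≤ f x := by
  have hn' : (2 : ℝ) ≤ n := by exact_mod_cast hn
  obtain ⟨F, hF, hFf, heq, hfin, hsup⟩ := hf.exists_measurable
  have hN : ∃ N : ℕ, ∫⁻ y in ball (0 : EuclideanSpace ℝ (Fin n)) N, F y ≠ 0 := by
    by_contra! hz
    refine hc ⟨0, ?_⟩
    have h1 : ∀ᵐ x : EuclideanSpace ℝ (Fin n), ∀ N : ℕ, x ∈ ball 0 (N : ℝ) → F x = 0 := by
      refine ae_all_iff.2 fun N => ?_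
      exact (ae_restrict_iff' measurableSet_ball).1 ((lintegral_eq_zero_iff hF).1 (hz N))
    filter_upwards [h1, hFf, hf.2] with x hx hx2 hx3
    obtain ⟨N, hN⟩ := exists_nat_gt ‖x‖
    have := hx N (by simpa using hN)
    rw [hx2, ENNReal.ofReal_eq_zero] at this
    exact le_antisymm this hx3.1
  obtain ⟨N, hN⟩ := hN
  have hpos : ∀ᵐ x, F x ≠ 0 := by
    filter_upwards [hsup] with x hx h0
    have h1 := hx (‖x‖ + N + 1) (by positivity)
    rw [h0, mul_zero, nonpos_iff_eq_zero] at h1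
    refine hN (le_antisymm ((lintegral_mono_set (ball_subset_ball' ?_)).trans h1.le) zero_le)
    rw [dist_zero_left]
    linarith
  set g : EuclideanSpace ℝ (Fin n) → ℝ := fun x => (∫⁻ y in ball x 1, F y).toReal with hg
  have hgs : IsSuperMean g := isSuperMean_setLIntegral_ball hF hfin hsup one_pos
  have hgpos : ∀ x, 0 < g x := by
    intro x
    refine ENNReal.toReal_pos (fun h0 => ?_) (hfin x 1).ne
    have h1 := (lintegral_eq_zero_iff hF).1 h0
    have h2 : ∀ᵐ y ∂(volume.restrict (ball x 1)), False := by
      filter_upwards [h1, ae_restrict_of_ae hpos] with y hy hy2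
      exact hy2 hy
    rw [eventually_false_iff_eq_bot, ae_eq_bot, Measure.restrict_eq_zero] at h2
    exact (measure_ball_pos volume x one_pos).ne' h2
  obtain ⟨c, hc0, hcg⟩ := hgs.exists_mul_one_add_sq_rpow_le hgpos
    (β := ((n : ℝ) - 2) / 2) (by rw [finrank_euclideanSpace_fin]; linarith) (by linarith)
  set V := volume.real (ball (0 : EuclideanSpace ℝ (Fin n)) 1) with hV
  have hV0 : 0 < V := ENNReal.toReal_pos (measure_ball_pos volume _ one_pos).ne'
    measure_ball_lt_top.ne
  refine ⟨c / V, by positivity, ?_⟩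
  filter_upwards [hsup, hFf, hf.2] with x hx hx2 hx3
  have h1 : g x ≤ V * f x := by
    have := ENNReal.toReal_mono (ENNReal.mul_ne_top measure_ball_lt_top.ne
      (by rw [hx2]; exact ENNReal.ofReal_ne_top)) (hx 1 one_pos)
    rwa [ENNReal.toReal_mul, hx2, ENNReal.toReal_ofReal hx3.1, Measure.addHaar_ball_center] at this
  have h2 := (hcg x).trans h1
  rw [div_mul_eq_mul_div, div_le_iff₀ hV0, mul_comm (f x)]
  exact h2

end FixedPoints

/-! ### Rearrangements and the tail condition -/

section Rearrangement

open Metric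

variable {n : ℕ}

theorem decRearrangement_mono {f g : EuclideanSpace ℝ (Fin n) → ℝ}
    (h : ∀ᵐ x, ‖f x‖ₑ ≤ ‖g x‖ₑ) (t : ℝ) : decRearrangement f t ≤ decRearrangement g t := by
  refine sInf_le_sInf fun s hs => le_trans (measure_mono_ae ?_) hs
  filter_upwards [h] with x hx hsx
  exact lt_of_lt_of_le hsx hx

theorem lorentzFunctional_mono {p : ℝ} (hp : 0 ≤ p) (w : ℝ → ℝ)
    {f g : EuclideanSpace ℝ (Fin n) → ℝ} (h : ∀ᵐ x, ‖f x‖ₑ ≤ ‖g x‖ₑ) :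
    lorentzFunctional p w f ≤ lorentzFunctional p w g := by
  unfold lorentzFunctional
  gcongr with t
  exact decRearrangement_mono h t

theorem volume_ball_eq (x : EuclideanSpace ℝ (Fin n)) {ρ : ℝ} (hn : n ≠ 0) (hρ : 0 ≤ ρ) :
    volume (ball x ρ) =
      ENNReal.ofReal (ρ ^ n * volume.real (ball (0 : EuclideanSpace ℝ (Fin n)) 1)) := by
  have : Nonempty (Fin n) := ⟨⟨0, Nat.pos_of_ne_zero hn⟩⟩
  rw [Measure.addHaar_ball _ x hρ, finrank_euclideanSpace_fin,
    ENNReal.ofReal_mul (by positivity), Measure.real,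
    ENNReal.ofReal_toReal measure_ball_lt_top.ne]

theorem unitBall_volume_pos : 0 < volume.real (ball (0 : EuclideanSpace ℝ (Fin n)) 1) :=
  ENNReal.toReal_pos (measure_ball_pos volume _ one_pos).ne' measure_ball_lt_top.ne

/-- A radially decreasing function is its own rearrangement, up to the change of variables
`t = |B(0, ρ)|`. -/
theorem decRearrangement_radial (hn : n ≠ 0) {U : ℝ → ℝ} (hU : AntitoneOn U (Ici 0))
    (hc : Continuous U) (h0 : ∀ ρ, 0 ≤ U ρ) {ρ : ℝ} (hρ : 0 ≤ ρ) :
    decRearrangement (fun x : EuclideanSpace ℝ (Fin n) => U ‖x‖)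
      (ρ ^ n * volume.real (ball (0 : EuclideanSpace ℝ (Fin n)) 1)) = ENNReal.ofReal (U ρ) := by
  simp_rw [decRearrangement, Real.enorm_of_nonneg (h0 _)]
  refine le_antisymm (sInf_le ?_) (le_sInf fun s hs => ?_)
  · rw [mem_ofPred_eq, ← volume_ball_eq 0 hn hρ]
    refine measure_mono fun x hx => ?_
    rw [mem_ball_zero_iff]
    by_contra! hle
    exact hx.not_ge (ENNReal.ofReal_le_ofReal (hU hρ (norm_nonneg x) hle))
  · by_contra! hlt
    have hcont : Continuous fun ρ => ENNReal.ofReal (U ρ) := ENNReal.continuous_ofReal.comp hc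
    obtain ⟨ρ', hlt', hρ'⟩ := (((hcont.continuousAt.eventually_const_lt hlt).filter_mono
      nhdsWithin_le_nhds).and (self_mem_nhdsWithin : Ioi ρ ∈ 𝓝[>] ρ)).exists
    have hρ0' : 0 ≤ ρ' := hρ.trans (le_of_lt hρ')
    have h1 : volume (ball (0 : EuclideanSpace ℝ (Fin n)) ρ') ≤
        volume {x : EuclideanSpace ℝ (Fin n) | s < ENNReal.ofReal (U ‖x‖)} := by
      refine measure_mono fun x hx => hlt'.trans_le ?_
      rw [mem_ball_zero_iff] at hx
      exact ENNReal.ofReal_le_ofReal (hU (norm_nonneg x) hρ0' hx.le)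
    have h2 := h1.trans hs
    rw [volume_ball_eq 0 hn hρ0', ENNReal.ofReal_le_ofReal_iff
      (mul_nonneg (by positivity) measureReal_nonneg)] at h2
    have h3 := le_of_mul_le_mul_right h2 unitBall_volume_pos
    exact absurd h3 (not_le.2 (pow_lt_pow_left₀ hρ' hρ hn))

theorem IsLorentzWeight.aestronglyMeasurable {w : ℝ → ℝ} (hw : IsLorentzWeight w) :
    AEStronglyMeasurable w (volume.restrict (Ioi 0)) := by
  have : Ioi (0 : ℝ) = ⋃ k : ℕ, Ioc 0 ((k : ℝ) + 1) := by
    ext t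
    simp only [mem_Ioi, mem_iUnion, mem_Ioc]
    refine ⟨fun h => ?_, fun ⟨_, h⟩ => h.1⟩
    obtain ⟨k, hk⟩ := exists_nat_gt t
    exact ⟨k, h, by linarith⟩
  rw [this, aestronglyMeasurable_iUnion_iff]
  exact fun k => (hw.integrableOn _ (by positivity)).aestronglyMeasurable

theorem decRearrangement_superharmonicBump (hn : 2 ≤ n) {c t : ℝ} (hc : 0 ≤ c) (ht : 0 < t) :
    decRearrangement (fun x => c * superharmonicBump n x) t =
      ENNReal.ofReal (c * (1 + (t / volume.real (ball (0 : EuclideanSpace ℝ (Fin n)) 1)) ^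
        (2 / (n : ℝ))) ^ (-(((n : ℝ) - 2) / 2))) := by
  set v := volume.real (ball (0 : EuclideanSpace ℝ (Fin n)) 1) with hv
  have hv0 : 0 < v := unitBall_volume_pos
  have hn' : (2 : ℝ) ≤ n := by exact_mod_cast hn
  have hn0 : n ≠ 0 := by omega
  set U : ℝ → ℝ := fun ρ => c * (1 + ρ ^ 2) ^ (-(((n : ℝ) - 2) / 2)) with hU
  have hUc : Continuous U := continuous_const.mul
    ((by fun_prop : Continuous fun ρ : ℝ => 1 + ρ ^ 2).rpow_const
      fun x => Or.inl (by positivity))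
  have hUa : AntitoneOn U (Ici 0) := by
    intro a ha b hb hab
    rw [mem_Ici] at ha hb
    refine mul_le_mul_of_nonneg_left ?_ hc
    exact Real.rpow_le_rpow_of_nonpos (by positivity) (by gcongr) (by linarith)
  have h := decRearrangement_radial hn0 hUa hUc (fun ρ => by positivity)
    (ρ := (t / v) ^ (1 / (n : ℝ))) (by positivity)
  have e1 : ((t / v) ^ (1 / (n : ℝ))) ^ n = t / v := by
    rw [one_div, Real.rpow_inv_natCast_pow (by positivity) hn0]
  have e2 : ((t / v) ^ (1 / (n : ℝ))) ^ 2 = (t / v) ^ (2 / (n : ℝ)) := by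
    rw [← Real.rpow_natCast, ← Real.rpow_mul (by positivity)]
    congr 1
    push_cast
    ring
  rw [← hv, e1, div_mul_cancel₀ _ hv0.ne'] at h
  simp only [hU, e2] at h
  exact h

/-- The rearrangement of the superharmonic bump is comparable to `t^(-(1 - 2/n))` on `(1, ∞)`. -/
theorem decRearrangement_superharmonicBump_rpow_bounds (hn : 2 ≤ n) {c p : ℝ} (hc : 0 < c)
    (hp : 0 ≤ p) :
    ∃ A B : ℝ, 0 < A ∧ 0 < B ∧ ∀ t : ℝ,
      (0 < t → decRearrangement (fun x => c * superharmonicBump n x) t ^ p ≤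
        ENNReal.ofReal B) ∧
      (1 < t →
        ENNReal.ofReal (A / t ^ (p * (1 - 2 / (n : ℝ)))) ≤
          decRearrangement (fun x => c * superharmonicBump n x) t ^ p ∧
        decRearrangement (fun x => c * superharmonicBump n x) t ^ p ≤
          ENNReal.ofReal (B / t ^ (p * (1 - 2 / (n : ℝ))))) := by
  set v := volume.real (ball (0 : EuclideanSpace ℝ (Fin n)) 1) with hv
  have hv0 : 0 < v := unitBall_volume_pos
  have hn' : (2 : ℝ) ≤ n := by exact_mod_cast hn
  set β := ((n : ℝ) - 2) / 2 with hβ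
  have hβ0 : 0 ≤ β := by rw [hβ]; linarith
  set a := (1 + (1 / v) ^ (2 / (n : ℝ))) with ha
  set b := (1 / v) ^ (2 / (n : ℝ)) with hb
  have hb0 : 0 < b := by positivity
  have ha0 : 0 < a := by positivity
  have hexp : ∀ t : ℝ, 0 < t → ∀ k : ℝ, 0 < k →
      (c * (k * t ^ (2 / (n : ℝ))) ^ (-β)) ^ p =
        (c * k ^ (-β)) ^ p / t ^ (p * (1 - 2 / (n : ℝ))) := by
    intro t ht k hk
    rw [Real.mul_rpow hk.le (by positivity), ← mul_assoc, Real.mul_rpow (by positivity)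
      (by positivity), ← Real.rpow_mul ht.le, ← Real.rpow_mul ht.le]
    have e : 2 / (n : ℝ) * -β * p = -(p * (1 - 2 / (n : ℝ))) := by
      rw [hβ]
      field_simp
    rw [e, Real.rpow_neg ht.le, div_eq_mul_inv _ (t ^ _)]
  refine ⟨(c * a ^ (-β)) ^ p, max (c ^ p) ((c * b ^ (-β)) ^ p), by positivity, by positivity,
    fun t => ⟨fun ht => ?_, fun ht => ?_⟩⟩
  · rw [decRearrangement_superharmonicBump hn hc.le ht, ENNReal.ofReal_rpow_of_nonneg
      (by positivity) hp]
    refine ENNReal.ofReal_le_ofReal (le_max_of_le_left ?_)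
    refine Real.rpow_le_rpow (by positivity) (mul_le_of_le_one_right hc.le ?_) hp
    refine Real.rpow_le_one_of_one_le_of_nonpos ?_ (by linarith)
    have : 0 ≤ (t / v) ^ (2 / (n : ℝ)) := by positivity
    linarith
  · have ht0 : 0 < t := by linarith
    have hle : 1 ≤ t ^ (2 / (n : ℝ)) := Real.one_le_rpow ht.le (by positivity)
    have e : (t / v) ^ (2 / (n : ℝ)) = b * t ^ (2 / (n : ℝ)) := by
      rw [hb, ← Real.mul_rpow (by positivity) ht0.le]
      congr 1
      ring
    rw [decRearrangement_superharmonicBump hn hc.le ht0, ENNReal.ofReal_rpow_of_nonneg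
      (by positivity) hp, ← hv, e]
    constructor
    · rw [← hexp t ht0 a ha0]
      refine ENNReal.ofReal_le_ofReal (Real.rpow_le_rpow (by positivity) ?_ hp)
      refine mul_le_mul_of_nonneg_left ?_ hc.le
      refine Real.rpow_le_rpow_of_nonpos (by positivity) ?_ (by linarith)
      rw [ha]
      nlinarith
    · refine (ENNReal.ofReal_le_ofReal ?_).trans (ENNReal.ofReal_le_ofReal
        (div_le_div_of_nonneg_right (le_max_right _ _) (by positivity)))
      rw [← hexp t ht0 b hb0]
      refine Real.rpow_le_rpow (by positivity) ?_ hp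
      refine mul_le_mul_of_nonneg_left ?_ hc.le
      exact Real.rpow_le_rpow_of_nonpos (by positivity) (by linarith) (by linarith)

theorem lorentzFunctional_lt_top_iff {p : ℝ} (hp : 0 < p) (w : ℝ → ℝ)
    (f : EuclideanSpace ℝ (Fin n) → ℝ) :
    lorentzFunctional p w f < ∞ ↔
      ∫⁻ t in Ioi (0 : ℝ), decRearrangement f t ^ p * ENNReal.ofReal (w t) < ∞ :=
  ENNReal.rpow_lt_top_iff_of_pos (by positivity)

/-- Sufficiency of the tail condition. -/
theorem memLorentz_superharmonicBump {p : ℝ} (hp : 0 < p) {w : ℝ → ℝ}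
    (hw : IsLorentzWeight w) (hn : 2 ≤ n)
    (h : IntegrableOn (fun t : ℝ => w t / t ^ (p * (1 - 2 / (n : ℝ)))) (Ioi 1) volume) :
    MemLorentz p w (superharmonicBump n) := by
  refine ⟨continuous_superharmonicBump.aestronglyMeasurable, ?_⟩
  obtain ⟨A, B, hA, hB, hAB⟩ := decRearrangement_superharmonicBump_rpow_bounds hn one_pos hp.le
  simp only [one_mul] at hAB
  rw [lorentzFunctional_lt_top_iff hp, ← Ioc_union_Ioi_eq_Ioi zero_le_one]
  refine (lintegral_union_le _ _ _).trans_lt (ENNReal.add_lt_top.2 ⟨?_, ?_⟩)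
  · calc ∫⁻ t in Ioc (0 : ℝ) 1, decRearrangement (superharmonicBump n) t ^ p * ENNReal.ofReal (w t)
        ≤ ∫⁻ t in Ioc (0 : ℝ) 1, ENNReal.ofReal (B * w t) := by
          refine setLIntegral_mono' measurableSet_Ioc fun t ht => ?_
          rw [ENNReal.ofReal_mul hB.le]
          gcongr
          exact (hAB t).1 ht.1
      _ < ∞ := ((hw.integrableOn 1 one_pos).const_mul B).lintegral_lt_top
  · calc ∫⁻ t in Ioi (1 : ℝ), decRearrangement (superharmonicBump n) t ^ p * ENNReal.ofReal (w t)
        ≤ ∫⁻ t in Ioi (1 : ℝ), ENNReal.ofReal (B * (w t / t ^ (p * (1 - 2 / (n : ℝ))))) := by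
          refine setLIntegral_mono' measurableSet_Ioi fun t ht => ?_
          rw [mem_Ioi] at ht
          have ht0 : 0 < t := by linarith
          rw [mul_div_left_comm, mul_comm (w t), ENNReal.ofReal_mul (by positivity)]
          gcongr
          exact ((hAB t).2 ht).2
      _ < ∞ := (h.const_mul B).lintegral_lt_top

/-- Necessity of the tail condition, for functions that decay no faster than the bump. -/
theorem MemLorentz.integrableOn_of_mul_superharmonicBump_le {p : ℝ} (hp : 0 < p) {w : ℝ → ℝ}
    (hw : IsLorentzWeight w) (hn : 2 ≤ n) {f : EuclideanSpace ℝ (Fin n) → ℝ}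
    (hf : MemLorentz p w f) {c : ℝ} (hc : 0 < c) (hcf : ∀ᵐ x, c * superharmonicBump n x ≤ f x) :
    IntegrableOn (fun t : ℝ => w t / t ^ (p * (1 - 2 / (n : ℝ)))) (Ioi 1) volume := by
  obtain ⟨A, B, hA, hB, hAB⟩ := decRearrangement_superharmonicBump_rpow_bounds hn hc hp.le
  have h1 : ∫⁻ t in Ioi (0 : ℝ), decRearrangement (fun x => c * superharmonicBump n x) t ^ p *
      ENNReal.ofReal (w t) < ∞ := by
    rw [← lorentzFunctional_lt_top_iff hp]
    refine (lorentzFunctional_mono hp.le w ?_).trans_lt hf.2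
    filter_upwards [hcf] with x hx
    have h0 : 0 ≤ c * superharmonicBump n x := mul_nonneg hc.le (superharmonicBump_pos x).le
    rw [Real.enorm_of_nonneg h0, Real.enorm_of_nonneg (h0.trans hx)]
    exact ENNReal.ofReal_le_ofReal hx
  have hmeas : AEStronglyMeasurable (fun t : ℝ => w t / t ^ (p * (1 - 2 / (n : ℝ))))
      (volume.restrict (Ioi 1)) := by
    refine (hw.aestronglyMeasurable.mono_set (Ioi_subset_Ioi zero_le_one)).aemeasurable.div ?_
      |>.aestronglyMeasurable
    exact (measurable_id.pow_const _).aemeasurable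
  have hint : IntegrableOn (fun t : ℝ => A * (w t / t ^ (p * (1 - 2 / (n : ℝ))))) (Ioi 1) := by
    refine ⟨hmeas.const_mul A, ?_⟩
    rw [hasFiniteIntegral_iff_enorm]
    refine lt_of_le_of_lt ?_ ((lintegral_mono_set (Ioi_subset_Ioi zero_le_one)).trans_lt h1)
    refine setLIntegral_mono' measurableSet_Ioi fun t ht => ?_
    rw [mem_Ioi] at ht
    have ht0 : 0 < t := by linarith
    have hw0 := hw.nonneg t ht0
    rw [Real.enorm_of_nonneg (by positivity), mul_div_left_comm, mul_comm (w t),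
      ENNReal.ofReal_mul (by positivity)]
    gcongr
    exact ((hAB t).2 ht).1
  have := hint.const_mul A⁻¹
  rw [IntegrableOn]
  simpa [← mul_assoc, hA.ne'] using this

/-- The existence criterion: the bump is the extremal candidate for membership in `Λ^p(w)`. -/
theorem exists_fixedPoint_iff {p : ℝ} (hp : 0 < p) {w : ℝ → ℝ} (hw : IsLorentzWeight w) :
    (∃ f : EuclideanSpace ℝ (Fin n) → ℝ,
        MemLorentz p w f ∧ IsNonconstant f ∧ IsMaximalFixedPoint f) ↔
      LorentzTailCondition n p w := by
  constructor
  · rintro ⟨f, hf, hnc, hfix⟩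
    have hn : 3 ≤ n := by
      by_contra! hlt
      exact hfix.not_isNonconstant (by omega) hnc
    obtain ⟨c, hc, hcf⟩ := hfix.exists_mul_superharmonicBump_le hnc (by omega)
    exact ⟨hn, hf.integrableOn_of_mul_superharmonicBump_le hp hw (by omega) hc hcf⟩
  · rintro ⟨hn, h⟩
    exact ⟨superharmonicBump n, memLorentz_superharmonicBump hp hw (by omega) h,
      isNonconstant_superharmonicBump hn, isMaximalFixedPoint_superharmonicBump (by omega)⟩

end Rearrangement

/-! ### Growth of the weight -/

section WeightGrowth

/-- The primitive `∫_0^t w` of a weight. -/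
noncomputable def weightMass (w : ℝ → ℝ) (t : ℝ) : ℝ := ∫ s in Ioc 0 t, w s

/-- The dyadic quotients `(2^k)^(-p) ∫_0^{2^k r} w`. -/
noncomputable def dyadicMass (p : ℝ) (w : ℝ → ℝ) (r : ℝ) (k : ℕ) : ℝ :=
  ((1 / 2 : ℝ) ^ p) ^ k * weightMass w (2 ^ k * r)

/-- The truncation `∫_r^R (r/t)^p w(t) dt` of the integral in the definition of `B_p`. -/
noncomputable def truncatedTail (p : ℝ) (w : ℝ → ℝ) (r R : ℝ) : ℝ :=
  ∫ t in Ioc r R, (r / t) ^ p * w t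

variable {p : ℝ} {w : ℝ → ℝ}

theorem IsLorentzWeight.integrableOn_Ioc (hw : IsLorentzWeight w) {a : ℝ} (ha : 0 ≤ a) (b : ℝ) :
    IntegrableOn w (Ioc a b) := by
  rcases le_or_gt b 0 with hb | hb
  · rw [Ioc_eq_empty (by linarith)]
    exact integrableOn_empty
  · exact (hw.integrableOn b hb).mono_set (Ioc_subset_Ioc_left ha)

theorem IsLorentzWeight.ofReal_weightMass (hw : IsLorentzWeight w) (t : ℝ) :
    ENNReal.ofReal (weightMass w t) = ∫⁻ s in Ioc 0 t, ENNReal.ofReal (w s) :=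
  ofReal_integral_eq_lintegral_ofReal (hw.integrableOn_Ioc le_rfl t)
    ((ae_restrict_iff' measurableSet_Ioc).2 (Eventually.of_forall fun s hs => hw.nonneg s hs.1))

theorem IsLorentzWeight.weightMass_nonneg (hw : IsLorentzWeight w) (t : ℝ) :
    0 ≤ weightMass w t :=
  setIntegral_nonneg measurableSet_Ioc fun s hs => hw.nonneg s hs.1

theorem IsLorentzWeight.dyadicMass_nonneg (hw : IsLorentzWeight w) (r : ℝ) (k : ℕ) :
    0 ≤ dyadicMass p w r k :=
  mul_nonneg (by positivity) (hw.weightMass_nonneg _)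

theorem dyadicMass_zero (r : ℝ) : dyadicMass p w r 0 = weightMass w r := by
  simp [dyadicMass]

theorem dyadicMass_add (r : ℝ) (i k : ℕ) :
    dyadicMass p w r (i + k) = ((1 / 2 : ℝ) ^ p) ^ k * dyadicMass p w (2 ^ k * r) i := by
  unfold dyadicMass
  rw [pow_add, pow_add, ← mul_assoc (2 ^ i : ℝ)]
  ring

theorem IsLorentzWeight.setIntegral_Ioc_eq (hw : IsLorentzWeight w) {a b : ℝ} (ha : 0 ≤ a)
    (hab : a ≤ b) : ∫ s in Ioc a b, w s = weightMass w b - weightMass w a := by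
  unfold weightMass
  rw [← Ioc_union_Ioc_eq_Ioc ha hab, setIntegral_union (Ioc_disjoint_Ioc_of_le le_rfl)
    measurableSet_Ioc (hw.integrableOn_Ioc le_rfl a) (hw.integrableOn_Ioc ha b)]
  ring

theorem IsLorentzWeight.integrableOn_tail (hw : IsLorentzWeight w) {r a : ℝ} (hr : 0 < r)
    (ha : 0 < a) (b : ℝ) : IntegrableOn (fun t => (r / t) ^ p * w t) (Ioc a b) := by
  have hc : ContinuousOn (fun t : ℝ => (r / t) ^ p) (Icc a b) := fun t ht => by
    have ht0 : t ≠ 0 := (ha.trans_le ht.1).ne'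
    have h1 : ContinuousAt (fun t : ℝ => r / t) t := continuousAt_const.div continuousAt_id ht0
    exact (h1.rpow_const (Or.inl (div_ne_zero hr.ne' ht0))).continuousWithinAt
  have hi : IntegrableOn w (Icc a b) := by
    rw [integrableOn_Icc_iff_integrableOn_Ioc]
    exact hw.integrableOn_Ioc ha.le b
  exact (hi.continuousOn_mul hc isCompact_Icc).mono_set Ioc_subset_Icc_self

/-- On a dyadic block, `(r/t)^p` is between its values at the endpoints. -/
theorem IsLorentzWeight.truncatedTail_succ_bounds (hw : IsLorentzWeight w) (hp : 0 ≤ p) {r : ℝ}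
    (hr : 0 < r) (k : ℕ) :
    truncatedTail p w r (2 ^ k * r) + (dyadicMass p w r (k + 1) -
        (1 / 2 : ℝ) ^ p * dyadicMass p w r k) ≤ truncatedTail p w r (2 ^ (k + 1) * r) ∧
      truncatedTail p w r (2 ^ (k + 1) * r) ≤
        truncatedTail p w r (2 ^ k * r) + 2 ^ p * dyadicMass p w r (k + 1) := by
  set a : ℝ := 2 ^ k * r with ha
  set b : ℝ := 2 ^ (k + 1) * r with hb
  have ha0 : 0 < a := by positivity
  have hra : r ≤ a := by
    rw [ha]
    exact le_mul_of_one_le_left hr.le (one_le_pow₀ one_le_two)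
  have hab : a ≤ b := by
    rw [ha, hb, pow_succ]
    nlinarith [pow_pos (two_pos (α := ℝ)) k]
  have hsplit : truncatedTail p w r b =
      truncatedTail p w r a + ∫ t in Ioc a b, (r / t) ^ p * w t := by
    unfold truncatedTail
    rw [← Ioc_union_Ioc_eq_Ioc hra hab, setIntegral_union (Ioc_disjoint_Ioc_of_le le_rfl)
      measurableSet_Ioc (hw.integrableOn_tail hr hr a) (hw.integrableOn_tail hr ha0 b)]
  have hpow : ∀ j : ℕ, (r / (2 ^ j * r)) ^ p = ((1 / 2 : ℝ) ^ p) ^ j := by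
    intro j
    rw [Real.rpow_pow_comm (by norm_num)]
    congr 1
    rw [one_div, inv_pow]
    field_simp
  have hmass := hw.setIntegral_Ioc_eq ha0.le hab
  have hmono := hw.weightMass_nonneg a
  have hlow : (r / b) ^ p * (weightMass w b - weightMass w a) ≤
      ∫ t in Ioc a b, (r / t) ^ p * w t := by
    rw [← hmass, ← integral_const_mul]
    refine setIntegral_mono_on ((hw.integrableOn_Ioc ha0.le b).const_mul _)
      (hw.integrableOn_tail hr ha0 b) measurableSet_Ioc fun t ht => ?_
    have ht0 : 0 < t := ha0.trans ht.1
    have := hw.nonneg t ht0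
    gcongr
    exact ht.2
  have hupp : ∫ t in Ioc a b, (r / t) ^ p * w t ≤
      (r / a) ^ p * (weightMass w b - weightMass w a) := by
    rw [← hmass, ← integral_const_mul]
    refine setIntegral_mono_on (hw.integrableOn_tail hr ha0 b)
      ((hw.integrableOn_Ioc ha0.le b).const_mul _) measurableSet_Ioc fun t ht => ?_
    have ht0 : 0 < t := ha0.trans ht.1
    have := hw.nonneg t ht0
    gcongr
    exact ht.1.le
  rw [hsplit]
  constructor
  · rw [hb, hpow] at hlow
    rw [← hb] at hlow
    have e : dyadicMass p w r (k + 1) - (1 / 2 : ℝ) ^ p * dyadicMass p w r k =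
        ((1 / 2 : ℝ) ^ p) ^ (k + 1) * (weightMass w b - weightMass w a) := by
      simp only [dyadicMass, ← ha, ← hb]
      ring
    linarith
  · rw [ha, hpow] at hupp
    rw [← ha] at hupp
    have e : 2 ^ p * dyadicMass p w r (k + 1) =
        ((1 / 2 : ℝ) ^ p) ^ k * weightMass w b := by
      have h2 : (2 : ℝ) ^ p * (1 / 2 : ℝ) ^ p = 1 := by
        rw [← Real.mul_rpow (by norm_num) (by norm_num)]
        norm_num
      simp only [dyadicMass, ← hb]
      linear_combination (((1 / 2 : ℝ) ^ p) ^ k * weightMass w b) * h2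
    have : 0 ≤ ((1 / 2 : ℝ) ^ p) ^ k * weightMass w a := by positivity
    linarith

theorem truncatedTail_self (r : ℝ) : truncatedTail p w r r = 0 := by
  simp [truncatedTail]

/-- If `∫_0^t w` drops by a factor `2` relative to `t^p` from each `r` to `2^K r`, then it grows
more slowly than `t^p` by a power of `t`, whence the convergence of the integrals below. -/
theorem exists_forall_lorentzTailCondition (hw : IsLorentzWeight w) (hp : 1 ≤ p) {K : ℕ}
    (hK : 1 ≤ K) (h : ∀ r, 0 < r → dyadicMass p w r K ≤ weightMass w r / 2) :
    ∃ n₀ : ℕ, ∀ m : ℕ, n₀ ≤ m → LorentzTailCondition m p w := by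
  obtain ⟨M, hM⟩ := exists_nat_gt (2 * p * K)
  refine ⟨max 3 M, fun m hm => ?_⟩
  have hm3 : 3 ≤ m := (le_max_left _ _).trans hm
  have hmM : 2 * p * K < m := hM.trans_le (by exact_mod_cast (le_max_right _ _).trans hm)
  have hm0 : (0 : ℝ) < m := by
    have : 0 < m := by omega
    exact_mod_cast this
  refine ⟨hm3, ?_⟩
  set q := p * (1 - 2 / (m : ℝ)) with hq
  have hq0 : 0 ≤ q := by
    refine mul_nonneg (by linarith) ?_
    rw [sub_nonneg, div_le_one hm0]
    exact_mod_cast (by omega : 2 ≤ m)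
  set L : ℝ := 2 ^ K with hL
  have hL1 : 1 < L := one_lt_pow₀ one_lt_two (by omega)
  have hL0 : 0 < L := by linarith
  have hgrow : ∀ j : ℕ, weightMass w (L ^ j) ≤ (L ^ p / 2) ^ j * weightMass w 1 := by
    intro j
    induction j with
    | zero => simp
    | succ j ih =>
      have h1 := h (L ^ j) (by positivity)
      have e : ((1 / 2 : ℝ) ^ p) ^ K = (L ^ p)⁻¹ := by
        rw [hL, ← Real.rpow_natCast, ← Real.rpow_natCast, ← Real.rpow_mul (by norm_num),
          ← Real.rpow_mul (by norm_num), one_div, Real.inv_rpow (by norm_num), mul_comm p]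
      rw [dyadicMass, e, ← hL, ← pow_succ', inv_mul_le_iff₀ (by positivity)] at h1
      calc weightMass w (L ^ (j + 1)) ≤ L ^ p * (weightMass w (L ^ j) / 2) := h1
        _ ≤ L ^ p * ((L ^ p / 2) ^ j * weightMass w 1 / 2) := by gcongr
        _ = _ := by ring
  -- The ratio of the geometric series that dominates the integral.
  set θ : ℝ := L ^ (p - q) / 2 with hθ
  have hθ0 : 0 ≤ θ := by positivity
  have hθ1 : θ < 1 := by
    rw [hθ, div_lt_one two_pos, hL, ← Real.rpow_natCast, ← Real.rpow_mul two_pos.le]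
    refine (Real.rpow_lt_rpow_of_exponent_lt one_lt_two ?_).trans_eq (Real.rpow_one 2)
    have : (K : ℝ) * (p - q) = 2 * p * K / m := by
      rw [hq]
      field_simp
      ring
    rw [this, div_lt_one hm0]
    exact hmM
  have hmeas : AEStronglyMeasurable (fun t : ℝ => w t / t ^ q) (volume.restrict (Ioi 1)) := by
    refine (hw.aestronglyMeasurable.mono_set (Ioi_subset_Ioi zero_le_one)).aemeasurable.div ?_
      |>.aestronglyMeasurable
    exact (measurable_id.pow_const _).aemeasurable
  refine ⟨hmeas, ?_⟩
  rw [hasFiniteIntegral_iff_enorm]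
  have hcover : Ioi (1 : ℝ) ⊆ ⋃ j : ℕ, Ioc (L ^ j) (L ^ (j + 1)) := by
    intro t ht
    obtain ⟨N, hN⟩ := pow_unbounded_of_one_lt t hL1
    have hex : ∃ N, t ≤ L ^ N := ⟨N, hN.le⟩
    have h0 : Nat.find hex ≠ 0 := fun h0 => by
      have := Nat.find_spec hex
      rw [h0, pow_zero] at this
      exact this.not_gt ht
    obtain ⟨j, hj⟩ := Nat.exists_eq_succ_of_ne_zero h0
    refine mem_iUnion.2 ⟨j, not_le.1 (Nat.find_min hex (by omega)), ?_⟩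
    have := Nat.find_spec hex
    rwa [hj] at this
  have hblock : ∀ j : ℕ, ∫⁻ t in Ioc (L ^ j) (L ^ (j + 1)), ‖w t / t ^ q‖ₑ ≤
      ENNReal.ofReal (L ^ p / 2 * weightMass w 1 * θ ^ j) := by
    intro j
    have hLj : 0 < L ^ j := by positivity
    calc ∫⁻ t in Ioc (L ^ j) (L ^ (j + 1)), ‖w t / t ^ q‖ₑ
        ≤ ∫⁻ t in Ioc (L ^ j) (L ^ (j + 1)),
            ENNReal.ofReal ((L ^ j) ^ q)⁻¹ * ENNReal.ofReal (w t) := by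
          refine setLIntegral_mono' measurableSet_Ioc fun t ht => ?_
          have ht0 : 0 < t := hLj.trans ht.1
          have hw0 := hw.nonneg t ht0
          rw [Real.enorm_of_nonneg (by positivity), ← ENNReal.ofReal_mul (by positivity),
            div_eq_inv_mul]
          refine ENNReal.ofReal_le_ofReal ?_
          gcongr
          exact ht.1.le
      _ ≤ ENNReal.ofReal ((L ^ j) ^ q)⁻¹ * ENNReal.ofReal (weightMass w (L ^ (j + 1))) := by
          rw [lintegral_const_mul' _ _ ENNReal.ofReal_ne_top, hw.ofReal_weightMass]
          gcongr
      _ ≤ ENNReal.ofReal (L ^ p / 2 * weightMass w 1 * θ ^ j) := by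
          rw [← ENNReal.ofReal_mul (by positivity)]
          refine ENNReal.ofReal_le_ofReal ?_
          calc ((L ^ j) ^ q)⁻¹ * weightMass w (L ^ (j + 1))
              ≤ ((L ^ j) ^ q)⁻¹ * ((L ^ p / 2) ^ (j + 1) * weightMass w 1) := by
                gcongr
                exact hgrow _
            _ = L ^ p / 2 * weightMass w 1 * θ ^ j := by
                have e1 : (L ^ j) ^ q = (L ^ q) ^ j := by
                  rw [← Real.rpow_natCast, ← Real.rpow_natCast, ← Real.rpow_mul hL0.le,
                    ← Real.rpow_mul hL0.le, mul_comm]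
                rw [e1, hθ, Real.rpow_sub hL0, div_pow, div_pow, div_pow, pow_succ, pow_succ]
                field_simp
  calc ∫⁻ t in Ioi (1 : ℝ), ‖w t / t ^ q‖ₑ
      ≤ ∫⁻ t in ⋃ j : ℕ, Ioc (L ^ j) (L ^ (j + 1)), ‖w t / t ^ q‖ₑ := lintegral_mono_set hcover
    _ ≤ ∑' j : ℕ, ∫⁻ t in Ioc (L ^ j) (L ^ (j + 1)), ‖w t / t ^ q‖ₑ := lintegral_iUnion_le _ _
    _ ≤ ∑' j : ℕ, ENNReal.ofReal (L ^ p / 2 * weightMass w 1 * θ ^ j) := ENNReal.tsum_le_tsum hblock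
    _ < ∞ := ((summable_geometric_of_lt_one hθ0 hθ1).mul_left _).tsum_ofReal_ne_top.lt_top

/-- Under `B_p` the dyadic quotients are summable and almost decreasing, both uniformly in `r`, so
that the `K`-th of them is `O(1 / K)`. -/
theorem IsBp.exists_dyadicMass_le (hB : IsBp p w) (hw : IsLorentzWeight w) (hp : 1 ≤ p) :
    ∃ K : ℕ, 1 ≤ K ∧ ∀ r, 0 < r → dyadicMass p w r K ≤ weightMass w r / 2 := by
  obtain ⟨C, hC⟩ := hB
  set q : ℝ := (1 / 2 : ℝ) ^ p with hq
  have hq0 : 0 < q := by positivity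
  have hq1 : q ≤ 1 / 2 := by
    simpa [hq] using Real.rpow_le_rpow_of_exponent_ge (by norm_num : (0 : ℝ) < 1 / 2) (by norm_num) hp
  have htail : ∀ r R, 0 < r → truncatedTail p w r R ≤ C * weightMass w r := by
    intro r R hr
    have h1 : ENNReal.ofReal (truncatedTail p w r R) ≤ ENNReal.ofReal (C * weightMass w r) := by
      rw [truncatedTail, ofReal_integral_eq_lintegral_ofReal (hw.integrableOn_tail hr hr R)
        ((ae_restrict_iff' measurableSet_Ioc).2 (Eventually.of_forall fun t ht => ?_)),
        ENNReal.ofReal_mul C.coe_nonneg, hw.ofReal_weightMass]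
      · refine (lintegral_mono_set Ioc_subset_Ioi_self).trans ((hC r hr).trans_eq ?_)
        simp
      · have ht0 : 0 < t := hr.trans ht.1
        have := hw.nonneg t ht0
        show 0 ≤ _
        positivity
    exact (ENNReal.ofReal_le_ofReal_iff (mul_nonneg C.2 (hw.weightMass_nonneg r))).1 h1
  have hsum : ∀ r, 0 < r → ∀ K : ℕ, (1 - q) * ∑ k ∈ Finset.range K, dyadicMass p w r k +
      dyadicMass p w r K - dyadicMass p w r 0 ≤ truncatedTail p w r (2 ^ K * r) := by
    intro r hr K
    induction K with
    | zero => simp [truncatedTail_self]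
    | succ K ih =>
      have := (hw.truncatedTail_succ_bounds (by linarith : 0 ≤ p) hr K).1
      rw [Finset.sum_range_succ]
      linarith
  have hsum' : ∀ r, 0 < r → ∀ K : ℕ, (1 - q) * ∑ k ∈ Finset.range K, dyadicMass p w r k +
      dyadicMass p w r K ≤ (C + 1) * weightMass w r := by
    intro r hr K
    have h1 := hsum r hr K
    have h2 := htail r (2 ^ K * r) hr
    rw [dyadicMass_zero] at h1
    linarith
  have hsnn : ∀ r K, 0 ≤ ∑ k ∈ Finset.range K, dyadicMass p w r k := fun r K =>
    Finset.sum_nonneg fun k _ => hw.dyadicMass_nonneg r k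
  have hone : ∀ r, 0 < r → ∀ K : ℕ, dyadicMass p w r K ≤ (C + 1) * weightMass w r := by
    intro r hr K
    have := hsum' r hr K
    have := mul_nonneg (by linarith : 0 ≤ 1 - q) (hsnn r K)
    linarith
  have hdecr : ∀ r, 0 < r → ∀ K k : ℕ, k ≤ K →
      dyadicMass p w r K ≤ (C + 1) * dyadicMass p w r k := by
    intro r hr K k hk
    obtain ⟨i, rfl⟩ := Nat.exists_eq_add_of_le' hk
    rw [dyadicMass_add]
    calc q ^ k * dyadicMass p w (2 ^ k * r) i
        ≤ q ^ k * ((C + 1) * weightMass w (2 ^ k * r)) := by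
          gcongr
          exact hone _ (by positivity) _
      _ = _ := by rw [dyadicMass]; ring
  obtain ⟨K, hK⟩ := exists_nat_gt (4 * ((C : ℝ) + 1) ^ 2)
  have hC0 : (0 : ℝ) ≤ C := C.2
  have hKpos : (0 : ℝ) < K := lt_of_le_of_lt (by positivity) hK
  refine ⟨K, by exact_mod_cast hKpos, fun r hr => ?_⟩
  have h1 : K * dyadicMass p w r K ≤
      (C + 1) * ∑ k ∈ Finset.range K, dyadicMass p w r k := by
    rw [Finset.mul_sum]
    refine le_trans (le_of_eq ?_) (Finset.sum_le_sum fun k hk =>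
      hdecr r hr K k (Finset.mem_range.1 hk).le)
    simp
  have h2 : ∑ k ∈ Finset.range K, dyadicMass p w r k ≤ 2 * ((C + 1) * weightMass w r) := by
    have := hsum' r hr K
    have := hw.dyadicMass_nonneg (p := p) r K
    nlinarith [hsnn r K]
  have h3 : K * dyadicMass p w r K ≤ K * (weightMass w r / 2) := by
    have h4 := mul_le_mul_of_nonneg_left h2 (by positivity : 0 ≤ (C : ℝ) + 1)
    nlinarith [hw.weightMass_nonneg r]
  exact le_of_mul_le_mul_left h3 hKpos

end WeightGrowth

/-! ### Step functions on shells of equal volume -/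

section StepFunctions

open Metric

variable {n : ℕ}

/-- The index `j` of the shell `j r ≤ |B(0, ‖x‖)| < (j + 1) r` that contains `x`; each of these
shells has volume `r`. -/
noncomputable def shellIndex (r : ℝ) (x : EuclideanSpace ℝ (Fin n)) : ℕ :=
  ⌊volume.real (ball (0 : EuclideanSpace ℝ (Fin n)) 1) * ‖x‖ ^ n / r⌋₊

theorem measurable_shellIndex (r : ℝ) :
    Measurable (shellIndex r : EuclideanSpace ℝ (Fin n) → ℕ) :=
  Nat.measurable_floor.comp (by fun_prop)

theorem volume_shellIndex_lt (hn : n ≠ 0) {r : ℝ} (hr : 0 < r) (j : ℕ) :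
    volume {x : EuclideanSpace ℝ (Fin n) | shellIndex r x < j} = ENNReal.ofReal (j * r) := by
  set v := volume.real (ball (0 : EuclideanSpace ℝ (Fin n)) 1) with hv
  have hv0 : 0 < v := unitBall_volume_pos
  set ρ : ℝ := (j * r / v) ^ (1 / (n : ℝ)) with hρ
  have hρ0 : 0 ≤ ρ := by positivity
  have hρn : ρ ^ n = j * r / v := by
    rw [hρ, one_div, Real.rpow_inv_natCast_pow (by positivity) hn]
  have hset : {x : EuclideanSpace ℝ (Fin n) | shellIndex r x < j} = ball 0 ρ := by
    ext x
    rw [mem_ofPred_eq, shellIndex, ← hv, Nat.floor_lt (by positivity), mem_ball_zero_iff,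
      div_lt_iff₀ hr, ← pow_lt_pow_iff_left₀ (norm_nonneg x) hρ0 hn, hρn, lt_div_iff₀ hv0, mul_comm]
  rw [hset, volume_ball_eq 0 hn hρ0, hρn, ← hv, div_mul_cancel₀ _ hv0.ne']

theorem map_shellIndex (hn : n ≠ 0) {r : ℝ} (hr : 0 < r) :
    (volume : Measure (EuclideanSpace ℝ (Fin n))).map (shellIndex r) =
      ENNReal.ofReal r • Measure.count := by
  refine Measure.ext_of_singleton fun j => ?_
  rw [Measure.map_apply (measurable_shellIndex r) (measurableSet_singleton j), Measure.smul_apply,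
    Measure.count_singleton, smul_eq_mul, mul_one]
  have hset : shellIndex r ⁻¹' {j} = {x : EuclideanSpace ℝ (Fin n) | shellIndex r x < (j + 1 : ℕ)} \
      {x | shellIndex r x < j} := by
    ext x
    simp only [mem_preimage, mem_singleton_iff, Set.mem_sdiff, mem_ofPred_eq]
    omega
  have hmeas : MeasurableSet {x : EuclideanSpace ℝ (Fin n) | shellIndex r x < j} :=
    measurable_shellIndex r (measurableSet_Iio (a := j))
  have hsub : {x : EuclideanSpace ℝ (Fin n) | shellIndex r x < j} ⊆
      {x | shellIndex r x < (j + 1 : ℕ)} := by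
    intro x hx
    rw [mem_ofPred_eq] at hx ⊢
    omega
  rw [hset, measure_sdiff hsub hmeas.nullMeasurableSet
    (by rw [volume_shellIndex_lt hn hr]; exact ENNReal.ofReal_ne_top),
    volume_shellIndex_lt hn hr, volume_shellIndex_lt hn hr, ← ENNReal.ofReal_sub _ (by positivity)]
  congr 1
  push_cast
  ring

/-- The rearrangement of a step function on shells depends only on how many of its values exceed
each level. -/
theorem decRearrangement_comp_shellIndex (hn : n ≠ 0) {r : ℝ} (hr : 0 < r) (c : ℕ → ℝ) (t : ℝ) :
    decRearrangement (fun x : EuclideanSpace ℝ (Fin n) => c (shellIndex r x)) t =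
      sInf {s : ℝ≥0∞ | ENNReal.ofReal r * ({j | s < ‖c j‖ₑ}.encard : ℝ≥0∞) ≤
        ENNReal.ofReal t} := by
  unfold decRearrangement
  congr 1
  ext s
  have h : volume {x : EuclideanSpace ℝ (Fin n) | s < ‖c (shellIndex r x)‖ₑ} =
      (volume : Measure (EuclideanSpace ℝ (Fin n))).map (shellIndex r) {j | s < ‖c j‖ₑ} := by
    rw [Measure.map_apply (measurable_shellIndex r) MeasurableSet.of_discrete]
    rfl
  rw [mem_ofPred_eq, mem_ofPred_eq, h, map_shellIndex hn hr, Measure.smul_apply,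
    Measure.count_apply MeasurableSet.of_discrete, smul_eq_mul]

theorem lorentzFunctional_comp_shellIndex_le (hn : n ≠ 0) {r p : ℝ} (hr : 0 < r) (hp : 0 ≤ p)
    (w : ℝ → ℝ) {c d : ℕ → ℝ}
    (h : ∀ s : ℝ≥0∞, {j | s < ‖c j‖ₑ}.encard ≤ {j | s < ‖d j‖ₑ}.encard) :
    lorentzFunctional p w (fun x : EuclideanSpace ℝ (Fin n) => c (shellIndex r x)) ≤
      lorentzFunctional p w (fun x : EuclideanSpace ℝ (Fin n) => d (shellIndex r x)) := by
  unfold lorentzFunctional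
  gcongr with t
  rw [decRearrangement_comp_shellIndex hn hr, decRearrangement_comp_shellIndex hn hr]
  refine sInf_le_sInf fun s hs => ?_
  rw [mem_ofPred_eq] at hs ⊢
  refine le_trans ?_ hs
  gcongr ENNReal.ofReal r * ?_
  exact_mod_cast h s

/-- A cyclic shift of the first `N` values of a sequence, the others being replaced by `0`. -/
noncomputable def cyclicShift (N : ℕ) (c : ℕ → ℝ) (s j : ℕ) : ℝ :=
  if j < N then c ((j + s) % N) else 0

theorem add_mod_injOn (N s : ℕ) : InjOn (fun j => (j + s) % N) {j | j < N} := by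
  intro i hi j hj hij
  have h : i ≡ j [MOD N] := Nat.ModEq.add_right_cancel' s hij
  rwa [Nat.ModEq, Nat.mod_eq_of_lt hi, Nat.mod_eq_of_lt hj] at h

theorem encard_cyclicShift_le (N : ℕ) (c : ℕ → ℝ) (s : ℕ) (a : ℝ≥0∞) :
    {j | a < ‖cyclicShift N c s j‖ₑ}.encard ≤ {j | a < ‖c j‖ₑ}.encard := by
  have hlt : ∀ j ∈ {j | a < ‖cyclicShift N c s j‖ₑ}, j < N := by
    intro j hj
    by_contra h
    simp [cyclicShift, h] at hj
  refine encard_le_encard_of_injOn (f := fun j => (j + s) % N) (fun j hj => ?_)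
    ((add_mod_injOn N s).mono hlt)
  have hjN := hlt j hj
  rw [mem_ofPred_eq] at hj ⊢
  simpa [cyclicShift, hjN] using hj

theorem sum_cyclicShift (N : ℕ) (c : ℕ → ℝ) (j : ℕ) :
    ∑ s ∈ Finset.range N, cyclicShift N c s j =
      if j < N then ∑ i ∈ Finset.range N, c i else 0 := by
  by_cases hj : j < N
  · simp only [cyclicShift, hj, if_true]
    have hmaps : ∀ s ∈ Finset.range N, (j + s) % N ∈ Finset.range N := fun s _ =>
      Finset.mem_range.2 (Nat.mod_lt _ (by omega))
    have hinj : Set.InjOn (fun s => (j + s) % N) (Finset.range N : Set ℕ) := by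
      intro a ha b hb hab
      simp only [add_comm j] at hab
      exact add_mod_injOn N j (by simpa using ha) (by simpa using hb) hab
    exact Finset.sum_nbij _ hmaps hinj
      (Finset.surjOn_of_injOn_of_card_le _ hmaps hinj le_rfl) fun _ _ => rfl
  · simp [cyclicShift, hj]

variable {p : ℝ} {w : ℝ → ℝ}

theorem le_lorentzFunctional_comp_shellIndex (hn : n ≠ 0) (hw : IsLorentzWeight w) (hp : 0 < p)
    {r : ℝ} (hr : 0 < r) (N : ℕ) {a : ℝ} (ha : 0 ≤ a) :
    ENNReal.ofReal (a * weightMass w (N * r) ^ (1 / p)) ≤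
      lorentzFunctional p w (fun x : EuclideanSpace ℝ (Fin n) =>
        if shellIndex r x < N then a else 0) := by
  have hdec : ∀ t ∈ Ioo 0 (N * r), ENNReal.ofReal a ≤ decRearrangement
      (fun x : EuclideanSpace ℝ (Fin n) => if shellIndex r x < N then a else 0) t := by
    intro t ht
    rw [decRearrangement_comp_shellIndex hn hr (fun j => if j < N then a else 0)]
    refine le_sInf fun s hs => ?_
    by_contra! hlt
    have hset : {j : ℕ | s < ‖(if j < N then a else 0 : ℝ)‖ₑ} = (Finset.range N : Set ℕ) := by
      ext j
      by_cases hj : j < N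
      · simp [hj, Real.enorm_of_nonneg ha, hlt]
      · simp [hj]
    rw [mem_ofPred_eq, hset, Set.encard_coe_eq_coe_finsetCard, Finset.card_range] at hs
    have h2 : ENNReal.ofReal (N * r) ≤ ENNReal.ofReal t := by
      rw [ENNReal.ofReal_mul (by positivity), ENNReal.ofReal_natCast, mul_comm]
      simpa using hs
    rw [ENNReal.ofReal_le_ofReal_iff ht.1.le] at h2
    exact h2.not_gt ht.2
  unfold lorentzFunctional
  calc ENNReal.ofReal (a * weightMass w (N * r) ^ (1 / p))
      = (ENNReal.ofReal a ^ p * ∫⁻ t in Ioo 0 (N * r), ENNReal.ofReal (w t)) ^ (1 / p) := by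
        rw [ENNReal.mul_rpow_of_nonneg _ _ (by positivity), ← ENNReal.rpow_mul,
          mul_one_div_cancel hp.ne', ENNReal.rpow_one, restrict_Ioo_eq_restrict_Ioc,
          ← hw.ofReal_weightMass, ENNReal.ofReal_mul ha,
          ENNReal.ofReal_rpow_of_nonneg (hw.weightMass_nonneg _) (by positivity)]
    _ ≤ _ := by
        gcongr
        rw [← lintegral_const_mul' _ _ (ENNReal.rpow_ne_top_of_nonneg hp.le ENNReal.ofReal_ne_top)]
        refine le_trans (setLIntegral_mono' measurableSet_Ioo fun t ht => ?_)
          (lintegral_mono_set Ioo_subset_Ioi_self)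
        gcongr
        exact hdec t ht

/-- A step function whose `j`-th value is at most `1 / (j + 1)` has a rearrangement bounded by
`min 1 (r / t)`. -/
theorem lorentzFunctional_comp_shellIndex_le_tail (hn : n ≠ 0) (hw : IsLorentzWeight w)
    (hp : 0 < p) {r : ℝ} (hr : 0 < r) {N : ℕ} (hN : 1 ≤ N) {c : ℕ → ℝ} (hc0 : ∀ j, 0 ≤ c j)
    (hc1 : ∀ j, c j ≤ 1 / ((j : ℝ) + 1)) (hcN : ∀ j, N ≤ j → c j = 0) :
    lorentzFunctional p w (fun x : EuclideanSpace ℝ (Fin n) => c (shellIndex r x)) ≤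
      ENNReal.ofReal ((weightMass w r + truncatedTail p w r (N * r)) ^ (1 / p)) := by
  have hcount : ∀ (m : ℕ) (s : ℝ≥0∞), (∀ j, m ≤ j → ‖c j‖ₑ ≤ s) →
      ENNReal.ofReal r * ({j | s < ‖c j‖ₑ}.encard : ℝ≥0∞) ≤ ENNReal.ofReal (m * r) := by
    intro m s hs
    have h1 : {j | s < ‖c j‖ₑ}.encard ≤ m := by
      calc {j | s < ‖c j‖ₑ}.encard ≤ (Finset.range m : Set ℕ).encard := by
            refine encard_le_encard fun j hj => ?_
            by_contra h
            exact (hs j (by simpa using h)).not_gt hj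
        _ = m := by rw [Set.encard_coe_eq_coe_finsetCard, Finset.card_range]
    have h2 : ({j | s < ‖c j‖ₑ}.encard : ℝ≥0∞) ≤ m := by exact_mod_cast h1
    rw [mul_comm (m : ℝ), ENNReal.ofReal_mul hr.le, ENNReal.ofReal_natCast]
    gcongr
  have hle : ∀ j, ‖c j‖ₑ ≤ ENNReal.ofReal (1 / ((j : ℝ) + 1)) := fun j => by
    rw [Real.enorm_of_nonneg (hc0 j)]
    exact ENNReal.ofReal_le_ofReal (hc1 j)
  have hanti : ∀ m j : ℕ, m ≤ j → ‖c j‖ₑ ≤ ENNReal.ofReal (1 / ((m : ℝ) + 1)) := fun m j hmj =>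
    (hle j).trans (ENNReal.ofReal_le_ofReal (by gcongr))
  set D := decRearrangement (fun x : EuclideanSpace ℝ (Fin n) => c (shellIndex r x)) with hD
  have hD1 : ∀ t, 0 ≤ t → D t ≤ 1 := by
    intro t ht
    rw [hD, decRearrangement_comp_shellIndex hn hr]
    refine sInf_le ((hcount 0 1 fun j hj => ?_).trans (by simp))
    simpa using hanti 0 j hj
  have hDr : ∀ t, 0 < t → D t ≤ ENNReal.ofReal (r / t) := by
    intro t ht
    have hfl := Nat.floor_le (div_nonneg ht.le hr.le)
    have hlf := Nat.lt_floor_add_one (t / r)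
    rw [hD, decRearrangement_comp_shellIndex hn hr]
    refine le_trans (sInf_le (a := ENNReal.ofReal (1 / ((⌊t / r⌋₊ : ℝ) + 1))) ?_)
      (ENNReal.ofReal_le_ofReal ?_)
    · refine (hcount ⌊t / r⌋₊ _ fun j hj => hanti _ j hj).trans (ENNReal.ofReal_le_ofReal ?_)
      rwa [le_div_iff₀ hr] at hfl
    · rw [div_lt_iff₀ hr] at hlf
      rw [div_le_div_iff₀ (by positivity) ht]
      linarith
  have hDN : ∀ t, N * r ≤ t → D t = 0 := by
    intro t ht
    rw [hD, decRearrangement_comp_shellIndex hn hr]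
    refine le_antisymm (sInf_le ((hcount N 0 fun j hj => ?_).trans
      (ENNReal.ofReal_le_ofReal ht))) zero_le
    simp [hcN j hj]
  have hrN : r ≤ N * r := le_mul_of_one_le_left hr.le (by exact_mod_cast hN)
  have hcover : Ioi (0 : ℝ) = Ioc 0 r ∪ (Ioc r (N * r) ∪ Ioi (N * r)) := by
    rw [Ioc_union_Ioi_eq_Ioi hrN, Ioc_union_Ioi_eq_Ioi hr.le]
  have htail0 : 0 ≤ truncatedTail p w r (N * r) := by
    refine setIntegral_nonneg measurableSet_Ioc fun t ht => ?_
    have ht0 : 0 < t := hr.trans ht.1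
    have := hw.nonneg t ht0
    positivity
  unfold lorentzFunctional
  rw [← ENNReal.ofReal_rpow_of_nonneg (add_nonneg (hw.weightMass_nonneg r) htail0) (by positivity)]
  refine ENNReal.rpow_le_rpow ?_ (by positivity)
  rw [hcover, ENNReal.ofReal_add (hw.weightMass_nonneg r) htail0]
  refine (lintegral_union_le _ _ _).trans (add_le_add ?_
    ((lintegral_union_le _ _ _).trans ((add_le_add ?_ (le_of_eq ?_)).trans_eq (add_zero _))))
  · rw [hw.ofReal_weightMass]
    refine setLIntegral_mono' measurableSet_Ioc fun t ht => ?_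
    refine mul_le_of_le_one_left zero_le ?_
    exact ENNReal.rpow_le_one (hD1 t ht.1.le) hp.le
  · rw [truncatedTail, ofReal_integral_eq_lintegral_ofReal (hw.integrableOn_tail hr hr _)
      ((ae_restrict_iff' measurableSet_Ioc).2 (Eventually.of_forall fun t ht => ?_))]
    · refine setLIntegral_mono' measurableSet_Ioc fun t ht => ?_
      have ht0 : 0 < t := hr.trans ht.1
      rw [ENNReal.ofReal_mul (by positivity), ← ENNReal.ofReal_rpow_of_nonneg (by positivity) hp.le]
      gcongr
      exact hDr t ht0
    · have ht0 : 0 < t := hr.trans ht.1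
      have := hw.nonneg t ht0
      show 0 ≤ _
      positivity
  · rw [setLIntegral_congr_fun measurableSet_Ioi (g := fun _ => 0)]
    · simp
    · intro t ht
      simp only [← hD, hDN t (le_of_lt ht), ENNReal.zero_rpow_of_pos hp, zero_mul]

end StepFunctions

/-! ### Normability and growth of the weight -/

section Normability

variable {n : ℕ} {p : ℝ} {w : ℝ → ℝ}

/-- The sum of all cyclic shifts of a step function is constant on the first `2^K` shells, while
each shift has the same rearrangement; the triangle inequality turns this into a growth bound. -/
theorem IsBanachLorentz.exists_sum_rpow_mul_dyadicMass_le (hB : IsBanachLorentz n p w)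
    (hw : IsLorentzWeight w) (hn : n ≠ 0) (hp : 0 < p) :
    ∃ C : ℝ, 0 < C ∧ ∀ r, 0 < r → ∀ (K M : ℕ) (c : ℕ → ℝ), 1 ≤ M → (∀ j, 0 ≤ c j) →
      (∀ j, c j ≤ 1 / ((j : ℝ) + 1)) → (∀ j, M ≤ j → c j = 0) →
      (∑ j ∈ Finset.range (2 ^ K), c j) ^ p * dyadicMass p w r K ≤
        C * (weightMass w r + truncatedTail p w r (M * r)) := by
  obtain ⟨S, hS, ν, -, ⟨C, hC, hν⟩, -⟩ := hB
  refine ⟨(C * C) ^ p, by positivity, fun r hr K M c hM hc0 hc1 hcM => ?_⟩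
  set N : ℕ := 2 ^ K with hN
  set H := ∑ j ∈ Finset.range N, c j with hH
  have hH0 : 0 ≤ H := Finset.sum_nonneg fun j _ => hc0 j
  set T := weightMass w r + truncatedTail p w r (M * r) with hT
  have hT0 : 0 ≤ T := by
    refine add_nonneg (hw.weightMass_nonneg r) (setIntegral_nonneg measurableSet_Ioc fun t ht => ?_)
    have ht0 : 0 < t := hr.trans ht.1
    have := hw.nonneg t ht0
    positivity
  have hΛ := lorentzFunctional_comp_shellIndex_le_tail hn hw hp hr hM hc0 hc1 hcM
  have hΛs : ∀ s, lorentzFunctional p w (fun x : EuclideanSpace ℝ (Fin n) =>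
      cyclicShift N c s (shellIndex r x)) ≤ ENNReal.ofReal (T ^ (1 / p)) := fun s =>
    (lorentzFunctional_comp_shellIndex_le hn hr hp.le w (encard_cyclicShift_le N c s)).trans hΛ
  have hmem : ∀ s, (fun x : EuclideanSpace ℝ (Fin n) => cyclicShift N c s (shellIndex r x)) ∈ S :=
    fun s => (hS _).2 ⟨((Measurable.of_discrete (f := cyclicShift N c s)).comp
      (measurable_shellIndex r)).aestronglyMeasurable, (hΛs s).trans_lt ENNReal.ofReal_lt_top⟩
  set φ : ℕ → S := fun s => ⟨_, hmem s⟩ with hφ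
  have hsum : ((∑ s ∈ Finset.range N, φ s : S) : EuclideanSpace ℝ (Fin n) → ℝ) =
      fun x => if shellIndex r x < N then H else 0 := by
    ext x
    rw [Submodule.coe_sum, Finset.sum_apply]
    exact sum_cyclicShift N c (shellIndex r x)
  have hlow : H * weightMass w (N * r) ^ (1 / p) ≤ (lorentzFunctional p w
      ((∑ s ∈ Finset.range N, φ s : S) : EuclideanSpace ℝ (Fin n) → ℝ)).toReal := by
    rw [← ENNReal.ofReal_le_iff_le_toReal ((hS _).1 (∑ s ∈ Finset.range N, φ s : S).2).2.ne, hsum]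
    exact le_lorentzFunctional_comp_shellIndex hn hw hp hr N hH0
  have hup : ∀ s, ν (φ s) ≤ C * T ^ (1 / p) := fun s => by
    refine (hν (φ s)).1.trans (mul_le_mul_of_nonneg_left ?_ hC.le)
    exact ENNReal.toReal_le_of_le_ofReal (by positivity) (hΛs s)
  have htri : ν (∑ s ∈ Finset.range N, φ s) ≤ ∑ s ∈ Finset.range N, ν (φ s) :=
    Finset.le_sum_of_subadditive ν (map_zero ν).le (map_add_le_add ν) _ _
  have key : H * weightMass w (N * r) ^ (1 / p) ≤ (C * C) * (N * T ^ (1 / p)) := by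
    calc H * weightMass w (N * r) ^ (1 / p) ≤ C * ν (∑ s ∈ Finset.range N, φ s) :=
          hlow.trans (hν _).2
      _ ≤ C * ∑ s ∈ Finset.range N, C * T ^ (1 / p) := by
          gcongr
          exact htri.trans (Finset.sum_le_sum fun s _ => hup s)
      _ = _ := by simp; ring
  have hW0 := hw.weightMass_nonneg (N * r)
  have hkey := Real.rpow_le_rpow (by positivity) key hp.le
  rw [Real.mul_rpow hH0 (by positivity), Real.mul_rpow (x := C * C) (by positivity) (by positivity),
    Real.mul_rpow (x := (N : ℝ)) (by positivity) (by positivity), ← Real.rpow_mul hW0, ← Real.rpow_mul hT0,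
    one_div_mul_cancel hp.ne', Real.rpow_one, Real.rpow_one] at hkey
  have hNp : ((1 / 2 : ℝ) ^ p) ^ K * (N : ℝ) ^ p = 1 := by
    rw [Real.rpow_pow_comm (by norm_num), ← Real.mul_rpow (by positivity) (by positivity), hN]
    push_cast
    rw [← mul_pow]
    norm_num
  have h2 : (2 : ℝ) ^ K * r = N * r := by rw [hN]; push_cast; rfl
  calc H ^ p * dyadicMass p w r K
      = ((1 / 2 : ℝ) ^ p) ^ K * (H ^ p * weightMass w (N * r)) := by
        rw [dyadicMass, h2]
        ring
    _ ≤ ((1 / 2 : ℝ) ^ p) ^ K * ((C * C) ^ p * ((N : ℝ) ^ p * T)) := by gcongr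
    _ = (((1 / 2 : ℝ) ^ p) ^ K * (N : ℝ) ^ p) * ((C * C) ^ p * T) := by ring
    _ = (C * C) ^ p * T := by rw [hNp, one_mul]

/-- Applied to the indicator of one shell, the shift argument bounds the dyadic quotients; applied
to the values `1 / (j + 1)`, whose sum is logarithmically large, it shows that the `K`-th of them
is `O(K^(1 - p))`. -/
theorem IsBanachLorentz.exists_dyadicMass_le (hB : IsBanachLorentz n p w)
    (hw : IsLorentzWeight w) (hn : n ≠ 0) (hp : 1 < p) :
    ∃ K : ℕ, 1 ≤ K ∧ ∀ r, 0 < r → dyadicMass p w r K ≤ weightMass w r / 2 := by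
  have hp0 : 0 < p := by linarith
  obtain ⟨C, hC, h⟩ := hB.exists_sum_rpow_mul_dyadicMass_le hw hn hp0
  have hgrow : ∀ r, 0 < r → ∀ K, dyadicMass p w r K ≤ C * weightMass w r := by
    intro r hr K
    have h1 := h r hr K 1 (fun j => if j = 0 then 1 else 0) le_rfl
      (fun j => by split_ifs <;> norm_num)
      (fun j => by
        split_ifs with hj
        · simp [hj]
        · positivity)
      (fun j hj => if_neg (by omega))
    rw [Nat.cast_one, one_mul, truncatedTail_self, add_zero, Finset.sum_ite_eq' (Finset.range _),
      if_pos (Finset.mem_range.2 (by positivity)), Real.one_rpow, one_mul] at h1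
    exact h1
  have htail : ∀ r, 0 < r → ∀ K : ℕ,
      truncatedTail p w r (2 ^ K * r) ≤ K * (2 ^ p * (C * weightMass w r)) := by
    intro r hr K
    induction K with
    | zero => simp [truncatedTail_self]
    | succ K ih =>
      have h1 := (hw.truncatedTail_succ_bounds hp0.le hr K).2
      have h2 : (2 : ℝ) ^ p * dyadicMass p w r (K + 1) ≤ 2 ^ p * (C * weightMass w r) := by
        gcongr
        exact hgrow r hr _
      push_cast
      linarith
  have hlog : ∀ r, 0 < r → ∀ K : ℕ, 1 ≤ K →
      ((K : ℝ) / 2) ^ p * dyadicMass p w r K ≤ C * (K * (1 + 2 ^ p * C) * weightMass w r) := by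
    intro r hr K hK
    have h1 := h r hr K (2 ^ K) (fun j => if j < 2 ^ K then 1 / ((j : ℝ) + 1) else 0)
      Nat.one_le_two_pow
      (fun j => by split_ifs <;> positivity)
      (fun j => by
        split_ifs
        · exact le_rfl
        · positivity)
      (fun j hj => if_neg (by omega))
    have hsum : (K : ℝ) / 2 ≤ ∑ j ∈ Finset.range (2 ^ K),
        (if j < 2 ^ K then 1 / ((j : ℝ) + 1) else 0) := by
      have h2 : ∑ j ∈ Finset.range (2 ^ K), (if j < 2 ^ K then 1 / ((j : ℝ) + 1) else 0) =
          (harmonic (2 ^ K) : ℝ) := by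
        rw [harmonic]
        push_cast
        refine Finset.sum_congr rfl fun j hj => ?_
        rw [if_pos (Finset.mem_range.1 hj), one_div]
      rw [h2]
      refine le_trans ?_ (log_add_one_le_harmonic (2 ^ K))
      have h3 : Real.log ((2 : ℝ) ^ K) ≤ Real.log ((2 ^ K : ℕ) + 1) := by
        refine Real.log_le_log (by positivity) ?_
        push_cast
        linarith
      rw [Real.log_pow, ← Nat.cast_add_one] at h3
      have h4 := Real.log_two_gt_d9
      have h5 : (0 : ℝ) ≤ K := by positivity
      nlinarith
    have hd := hw.dyadicMass_nonneg (p := p) r K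
    have hW := hw.weightMass_nonneg r
    have hK1 : (1 : ℝ) ≤ K := by exact_mod_cast hK
    have h6 := htail r hr K
    calc ((K : ℝ) / 2) ^ p * dyadicMass p w r K ≤ _ := by gcongr
      _ ≤ _ := h1
      _ ≤ C * (K * (1 + 2 ^ p * C) * weightMass w r) := by
          push_cast
          gcongr
          nlinarith
  set B : ℝ := 2 ^ p * (C * (1 + 2 ^ p * C)) with hB'
  have hlim : Tendsto (fun K : ℕ => B * (K : ℝ) ^ (-(p - 1))) atTop (𝓝 (B * 0)) :=
    ((tendsto_rpow_neg_atTop (by linarith : 0 < p - 1)).comp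
      tendsto_natCast_atTop_atTop).const_mul B
  rw [mul_zero] at hlim
  obtain ⟨K, hKlt, hK1⟩ := ((hlim.eventually_lt_const (by norm_num : (0 : ℝ) < 1 / 2)).and
    (eventually_ge_atTop 1)).exists
  refine ⟨K, hK1, fun r hr => ?_⟩
  have hK0 : (0 : ℝ) < K := by exact_mod_cast hK1
  have h1 := hlog r hr K hK1
  have hKp : 0 < (K : ℝ) ^ p := by positivity
  have h2 : dyadicMass p w r K ≤ B * (K : ℝ) ^ (-(p - 1)) * weightMass w r := by
    rw [Real.div_rpow hK0.le two_pos.le, div_mul_eq_mul_div, div_le_iff₀ (by positivity)] at h1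
    rw [← mul_le_mul_iff_right₀ hKp]
    have e : (K : ℝ) ^ p * (K : ℝ) ^ (-(p - 1)) = K := by
      rw [← Real.rpow_add hK0]
      simp
    calc (K : ℝ) ^ p * dyadicMass p w r K
        ≤ C * (K * (1 + 2 ^ p * C) * weightMass w r) * 2 ^ p := h1
      _ = B * K * weightMass w r := by rw [hB']; ring
      _ = (K : ℝ) ^ p * (B * (K : ℝ) ^ (-(p - 1)) * weightMass w r) := by
          linear_combination (-(B * weightMass w r)) * e
  have hW := hw.weightMass_nonneg r
  nlinarith

end Normability

theorem mainTheorem2 (n : ℕ) (hn : 1 ≤ n) (p : ℝ) (hp : 1 ≤ p) (w : ℝ → ℝ)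
    (hw : IsLorentzWeight w)
    (hB : IsBanachLorentz n p w ∨ (1 < p ∧ IsBp p w) ∨ (p = 1 ∧ IsBOneInfty w)) :
    ((∃ f : EuclideanSpace ℝ (Fin n) → ℝ,
        MemLorentz p w f ∧ IsNonconstant f ∧ IsMaximalFixedPoint f) ↔
      LorentzTailCondition n p w) ∧
    (1 < p → ∃ n₀ : ℕ, ∀ m : ℕ, n₀ ≤ m →
      LorentzTailCondition m p w ∧
      ∃ f : EuclideanSpace ℝ (Fin m) → ℝ,
        MemLorentz p w f ∧ IsNonconstant f ∧ IsMaximalFixedPoint f) := by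
  have hp0 : 0 < p := by linarith
  refine ⟨exists_fixedPoint_iff hp0 hw, fun hp1 => ?_⟩
  have hK : ∃ K : ℕ, 1 ≤ K ∧ ∀ r, 0 < r → dyadicMass p w r K ≤ weightMass w r / 2 := by
    rcases hB with hB | ⟨-, hB⟩ | ⟨hp', -⟩
    · exact hB.exists_dyadicMass_le hw (by omega) hp1
    · exact hB.exists_dyadicMass_le hw hp
    · exact absurd hp' hp1.ne'
  obtain ⟨K, hK1, hK⟩ := hK
  obtain ⟨n₀, h⟩ := exists_forall_lorentzTailCondition hw hp hK1 hK
  exact ⟨n₀, fun m hm => ⟨h m hm, (exists_fixedPoint_iff hp0 hw).2 (h m hm)⟩⟩
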